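/- **Setting.** Let $d\ge 1$, $I_\pm=\{\pm1,\dots,\pm d\}$, let $r:I_\pm\to\mathbb Z^d$ be a jump function, $\bar r=\frac1{2d}\sum_{\tau}r(\tau)$, let $C(\omega)$ be a random unitary matrix on $\mathbb C^{2d}$ (with canonical basis $|\tau\rangle$, $\tau\in I_\pm$) defined on a probability space $(\Omega,\mu)$, and let $\varphi_0\in\mathbb C^{2d}$ be a unit vector. For $\bar\omega=(\omega_1,\omega_2,\dots)$ i.i.d. with law $\mu$, the quantum walk on $\mathbb C^{2d}\otimes\ell^2(\mathbb Z^d)$ is $\psi_n=U_n\cdots U_1(\varphi_0\otimes|0\rangle)$ with $U_k=S(C(\omega_k)\otimes\mathbb I)$ and $S(|\tau\rangle\otimes|x\rangle)=|\tau\rangle\otimes|x+r(\tau)\rangle$. Let $X_n$ be a random variable in $\mathbb Z^d$ with the averaged law $w_k(n)=\mathbb E\,\|\psi_n(k)\|^2$. Let $\mathcal E=\mathbb E\,(C(\omega)\otimes\overline{C(\omega)})$, $D(y,y')=\sum_{\tau,\tau'}e^{i(y\cdot r(\tau)+y'\cdot r(\tau'))}|\tau\otimes\tau'\rangle\langle\tau\otimes\tau'|$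 and $\mathcal M(y,y')=D(y,y')\mathcal E$. *Assumption S*: for all $v\in\mathbb T^d=[0,2\pi)^d$, the only eigenvalue of $\mathcal M(-v,v)$ on the unit circle is $1$, and it is simple. Let $P$ be the orthogonal projector onto $\mathbb C\sum_\tau|\tau\otimes\tau\rangle$ and let $S_v(1)$ be the value at $z=1$ of $S_v(z)=(\mathcal M(-v,v)-z)^{-1}-\frac{P}{1-z}$ (the reduced resolvent). The diffusion matrix $\mathbb D(v)$ of the centred walk is the real symmetric $d\times d$ matrix with, writing $\rho(\tau)=r(\tau)-\bar r$, $$\langle y,\mathbb D(v)y\rangle=-\frac1{2d}\sum_\tau (y\cdot\rho(\tau))^2-\frac1d\sum_{\tau,\tau'}(y\cdot\rho(\tau))(y\cdot\rho(\tau'))\,\langle\tau\otimes\tau|S_v(1)\,\tau'\otimes\tau'\rangle .$$ Let $(a_n)$ be a sequence of positive reals with $a_n\to\infty$ and $a_n/n\to0$, put $Y_n=(X_n-n\bar r)/\sqrt{n a_n}$ and $\tilde\Lambda_n(y)=\ln\mathbb E_{w(n)}(e^{y\cdot Y_n})$. **Proposition.** Assume S and $\mathbb D(v)>0$ (positive definite)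 for all $v\in\mathbb T^d$. For every $y\in\mathbb R^d$, the map $q_y:\mathbb T^d\ni v\mapsto\langle y,\mathbb D(v)y\rangle$ has at least one (global) maximum point. 1. Let $y\in\mathbb R^d$ be such that $q_y$ is constant or has only finitely many maximum points, all of them non-degenerate. Then, for any maximum point $v_1(y)$ of $q_y$, $$\lim_{n\to\infty}\frac1{a_n}\tilde\Lambda_n(a_ny)=\tfrac12\langle y,\mathbb D(v_1(y))y\rangle=:L(y).$$ 2. If the assumption of 1 holds for all $y\in\mathbb R^d\setminus\{0\}$, then $L$ is convex on $\mathbb R^d$. 3. Let $U\subset\mathbb R^d$ be open and $J\in\mathbb N$ be such that, for every $y\in U$, $q_y$ has exactly $J$ maximum points $v_1(y),\dots,v_J(y)$, all of them non-degenerate. Then $L$ is $C^\infty$ on $U$. If this holds with $U=\mathbb R^d\setminus\{0\}$, then $L$ is moreover $C^1$ on $\mathbb R^d$. 4. If $\mathbb D(v)$ does not depend on $v$, or if $d=1$, then $L(y)=\frac12\max_v\langle y,\mathbb D(v)y\rangle$ is $C^\infty$ on $\mathbb R^d$. -/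

import Mathlib

open Filter Topology MeasureTheory Matrix

namespace RandomQW

noncomputable section

/-- The index set `{±1, …, ±d}` of the canonical basis of the coin space `ℂ^{2d}`:
the pair `(j, ε)` stands for `ε (j + 1)`. -/
abbrev CoinIdx (d : ℕ) : Type := Fin d × ℤˣ

/-- A coin matrix: a unitary matrix on `ℂ^{2d}`. -/
abbrev Coin (d : ℕ) : Type := Matrix.unitaryGroup (CoinIdx d) ℂ

/-- Wave functions of a walker on `ℤ^d` with internal state in `ℂ^{2d}`; `ψ x τ` is the
coefficient of `|τ⟩ ⊗ |x⟩`. -/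
abbrev Wave (d : ℕ) : Type := (Fin d → ℤ) → CoinIdx d → ℂ

variable {d : ℕ} {Ω : Type*} [MeasurableSpace Ω]

/-- One step `U = S (C ⊗ 1)`: update of the coin state by `C`, then the shift
`|τ⟩ ⊗ |x⟩ ↦ |τ⟩ ⊗ |x + r(τ)⟩`. -/
def step (r : CoinIdx d → Fin d → ℤ) (C : Coin d) (ψ : Wave d) : Wave d :=
  fun x τ => ((C : Matrix (CoinIdx d) (CoinIdx d) ℂ) *ᵥ ψ (x - r τ)) τ

/-- The state at time `n`, starting from `φ₀ ⊗ |0⟩`, when the coin `C_{k+1}` used at the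
`(k+1)`-st step is `Cs k`. -/
def state (r : CoinIdx d → Fin d → ℤ) (φ₀ : CoinIdx d → ℂ) (Cs : ℕ → Coin d) : ℕ → Wave d
  | 0 => fun x τ => if x = 0 then φ₀ τ else 0
  | n + 1 => step r (Cs n) (state r φ₀ Cs n)

/-- The quantum mechanical probability `W_k(n)` to find the walker at site `k` at time `n`. -/
def siteProb (r : CoinIdx d → Fin d → ℤ) (φ₀ : CoinIdx d → ℂ) (Cs : ℕ → Coin d) (n : ℕ)
    (k : Fin d → ℤ) : ℝ :=
  ∑ τ, ‖state r φ₀ Cs n k τ‖ ^ 2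

/-- The averaged distribution `w_k(n) = 𝔼 (W_k(n))`, the expectation being with respect to the
i.i.d. sequence of coin matrices `C(ω₁), C(ω₂), …` on the product space `(Ω^ℕ, μ^{⊗ℕ})`. -/
def avgProb (μ : Measure Ω) [IsProbabilityMeasure μ] (C : Ω → Coin d)
    (r : CoinIdx d → Fin d → ℤ) (φ₀ : CoinIdx d → ℂ) (n : ℕ) (k : Fin d → ℤ) : ℝ :=
  ∫ ω : ℕ → Ω, siteProb r φ₀ (fun j => C (ω j)) n k ∂(Measure.infinitePi fun _ : ℕ => μ)

/-- The mean jump `r̄ = (1/2d) ∑_τ r(τ)`. -/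
def meanJump (r : CoinIdx d → Fin d → ℤ) : Fin d → ℝ :=
  fun i => (1 / (2 * d : ℝ)) * ∑ τ, (r τ i : ℝ)

/-- `Y_n` at a site: `(k - n r̄) / √(n a_n)`. -/
def rescaledPos (r : CoinIdx d → Fin d → ℤ) (a : ℕ → ℝ) (n : ℕ) (k : Fin d → ℤ) : Fin d → ℝ :=
  fun i => ((k i : ℝ) - n * meanJump r i) / Real.sqrt (n * a n)

/-- The logarithmic generating function `Λ̃_n(y) = ln 𝔼_{w(n)} (exp (y · Y_n))`.
The distribution `w(n)` has finite support, so that the sum over `ℤ^d` is finite. -/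
def logGen (μ : Measure Ω) [IsProbabilityMeasure μ] (C : Ω → Coin d)
    (r : CoinIdx d → Fin d → ℤ) (φ₀ : CoinIdx d → ℂ) (a : ℕ → ℝ) (n : ℕ) (y : Fin d → ℝ) : ℝ :=
  Real.log (∑' k : Fin d → ℤ, avgProb μ C r φ₀ n k * Real.exp (y ⬝ᵥ rescaledPos r a n k))

/-- The matrix `𝓔 = 𝔼 (C(ω) ⊗ conj C(ω))` on `ℂ^{2d} ⊗ ℂ^{2d}`. -/
def meanTensor (μ : Measure Ω) (C : Ω → Coin d) :
    Matrix (CoinIdx d × CoinIdx d) (CoinIdx d × CoinIdx d) ℂ :=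
  Matrix.of fun S T => ∫ ω, (C ω : Matrix (CoinIdx d) (CoinIdx d) ℂ) S.1 T.1 *
    star ((C ω : Matrix (CoinIdx d) (CoinIdx d) ℂ) S.2 T.2) ∂μ

/-- The diagonal matrix `D(y, y')` with entries `exp (i (y · r(τ) + y' · r(τ')))`. -/
def phase (r : CoinIdx d → Fin d → ℤ) (y y' : Fin d → ℝ) :
    Matrix (CoinIdx d × CoinIdx d) (CoinIdx d × CoinIdx d) ℂ :=
  Matrix.diagonal fun T => Complex.exp (Complex.I *
    (((y ⬝ᵥ fun i => (r T.1 i : ℝ)) + (y' ⬝ᵥ fun i => (r T.2 i : ℝ)) : ℝ) : ℂ))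

/-- `𝓜(y, y') = D(y, y') 𝓔`. -/
def avgM (μ : Measure Ω) (C : Ω → Coin d) (r : CoinIdx d → Fin d → ℤ) (y y' : Fin d → ℝ) :
    Matrix (CoinIdx d × CoinIdx d) (CoinIdx d × CoinIdx d) ℂ :=
  phase r y y' * meanTensor μ C

/-- Spectral assumption: for every `v`, the only eigenvalue of `𝓜(-v, v)` on the unit circle
is `1`, and it is simple. -/
def AssumptionS (μ : Measure Ω) (C : Ω → Coin d) (r : CoinIdx d → Fin d → ℤ) : Prop :=
  ∀ v : Fin d → ℝ,
    spectrum ℂ (avgM μ C r (-v) v) ∩ Metric.sphere (0 : ℂ) 1 = {1} ∧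
      (avgM μ C r (-v) v).charpoly.rootMultiplicity 1 = 1

/-- The orthogonal projector `P` onto the line spanned by `∑_τ |τ ⊗ τ⟩`, whose squared norm
is `2d`. -/
def projP (d : ℕ) : Matrix (CoinIdx d × CoinIdx d) (CoinIdx d × CoinIdx d) ℂ :=
  Matrix.of fun S T => if S.1 = S.2 ∧ T.1 = T.2 then 1 / (2 * d : ℂ) else 0

/-- The reduced resolvent `S_v(1)`, where `(𝓜(-v,v) - z)⁻¹ = P / (1 - z) + S_v(z)`. Under the
spectral assumption, `𝓜(-v,v) - 1` maps the range of `1 - P` bijectively to itself, and `S_v(1)`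
is its inverse there and `0` on the range of `P`; so `𝓜(-v,v) - 1 + P` is invertible,
with inverse `S_v(1) + P`. -/
def redResolvent (μ : Measure Ω) (C : Ω → Coin d) (r : CoinIdx d → Fin d → ℤ) (v : Fin d → ℝ) :
    Matrix (CoinIdx d × CoinIdx d) (CoinIdx d × CoinIdx d) ℂ :=
  (avgM μ C r (-v) v - 1 + projP d)⁻¹ - projP d

/-- The diffusion matrix `𝔻(v)`: the real symmetric matrix of the quadratic form
`⟨y, 𝔻(v) y⟩ = -(1/2d) ∑_τ (y · ρ(τ))²
  - (1/d) ∑_{τ,τ'} (y · ρ(τ)) (y · ρ(τ')) ⟨τ⊗τ, S_v(1) τ'⊗τ'⟩`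
with the centred jumps `ρ(τ) = r(τ) - r̄` (the matrix elements of `S_v(1)` which occur
are real). -/
def diffusion (μ : Measure Ω) (C : Ω → Coin d) (r : CoinIdx d → Fin d → ℤ) (v : Fin d → ℝ) :
    Matrix (Fin d) (Fin d) ℝ :=
  let ρ : CoinIdx d → Fin d → ℝ := fun τ i => (r τ i : ℝ) - meanJump r i
  Matrix.of fun j k =>
    -(1 / (2 * d : ℝ)) * ∑ τ, ρ τ j * ρ τ k
      - (1 / (2 * d : ℝ)) * ∑ τ, ∑ τ', (ρ τ j * ρ τ' k + ρ τ k * ρ τ' j) *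
          (redResolvent μ C r v (τ, τ) (τ', τ')).re

/-- `⟨y, 𝔻(v) y⟩`. -/
def quad (μ : Measure Ω) (C : Ω → Coin d) (r : CoinIdx d → Fin d → ℤ) (y v : Fin d → ℝ) : ℝ :=
  y ⬝ᵥ (diffusion μ C r v *ᵥ y)

/-- The (global) maximum points of `v ↦ g v` on the torus, viewed as `[0, 2π)^d`. -/
def maxPoints (g : (Fin d → ℝ) → ℝ) : Set (Fin d → ℝ) :=
  {v | (∀ i, v i ∈ Set.Ico 0 (2 * Real.pi)) ∧ ∀ w, g w ≤ g v}

/-- The Hessian matrix of `g` at `v`. -/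
def hessian (g : (Fin d → ℝ) → ℝ) (v : Fin d → ℝ) : Matrix (Fin d) (Fin d) ℝ :=
  Matrix.of fun j k => iteratedFDeriv ℝ 2 g v ![Pi.single j 1, Pi.single k 1]

/-- `g` has finitely many maximum points on the torus, all of them non-degenerate. -/
def FiniteNondegMax (g : (Fin d → ℝ) → ℝ) : Prop :=
  (maxPoints g).Finite ∧ ∀ v ∈ maxPoints g, (hessian g v).det ≠ 0

/-- `g` is constant, or it has finitely many maximum points, all of them non-degenerate. -/
def ConstOrNondegMax (g : (Fin d → ℝ) → ℝ) : Prop :=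
  (∀ v w, g v = g w) ∨ FiniteNondegMax g

end

end RandomQW

/-!
The exponential tilt `e^{t y · (x - n r̄)}` is shared equally between the wave function and its
conjugate. By Plancherel's identity `𝔼 e^{t y · (X_n - n r̄)}` is then the average over the torus
of the expected squared norm `N_n(v)` of the Fourier transform of the tilted wave function. As the
coins are independent, the averaged correlations of the `2d` components of this Fourier transform
evolve linearly, under `e^{t R} 𝓜(-v, v)` with `R` the symmetrised centred jump, and `N_n(v)` is
their trace.

Under assumption S the trace functional `∑_τ ⟨τ ⊗ τ|` is the left fixed vector of `𝓜(-v, v)`.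
Second order perturbation theory deforms it into an approximate left eigenvector with eigenvalue
`1 + t² ⟨y, 𝔻(v) y⟩ / 2` up to an error `O(t³)`, uniformly in `v`; the diffusion matrix appears as
the solvability condition at second order. The correlation matrix is positive, so its trace
dominates its entries, and pairing the correlations with the approximate eigenvector bounds
`N_n(v)` from both sides by `e^{n t² (⟨y, 𝔻(v) y⟩ / 2 ± δ)}` up to constant factors. With
`t = √(a_n / n)`, Laplace's principle on the torus gives the limit.

The limit is convex because logarithmic moment generating functions are. Near a parameter `y₀` with
finitely many nondegenerate maximum points, the implicit function theorem continues them to smooth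
branches of critical points, which contain all maximum points for nearby `y`; if the number of
maximum points is constant, every branch consists of maximum points, so the maximum is smooth. At
the origin the limit is `C¹` because it is homogeneous of degree two.
-/

namespace RandomQW

noncomputable section

/-! ### Matrices with a simple eigenvalue -/

section SimpleEigenvalue

variable {K n : Type*} [Field K] [Fintype n] [DecidableEq n] {M : Matrix n n K} {φ ψ : n → K}
  {c : K}

lemma isUnit_sub_one_add_smul_vecMulVec (hMψ : M *ᵥ ψ = ψ) (hφM : φ ᵥ* M = φ)
    (hφψ : φ ⬝ᵥ ψ ≠ 0) (hc : c ≠ 0) (hM : M.charpoly.rootMultiplicity 1 ≤ 1) :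
    IsUnit (M - 1 + c • vecMulVec ψ φ) := by
  rw [← mulVec_injective_iff_isUnit, ← coe_mulVecLin, ← LinearMap.ker_eq_bot,
    LinearMap.ker_eq_bot']
  intro x hx
  rw [mulVecLin_apply, add_mulVec, sub_mulVec, one_mulVec, smul_mulVec, vecMulVec_mulVec,
    op_smul_eq_smul] at hx
  have hφx : φ ⬝ᵥ x = 0 := by
    have := congrArg (φ ⬝ᵥ ·) hx
    simpa [dotProduct_mulVec, hφM, hc, hφψ] using this
  have hMx : M *ᵥ x = x := by simpa [hφx, sub_eq_zero] using hx
  have hψ : ψ ≠ 0 := by rintro rfl; simp at hφψ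
  have hdim : Module.finrank K (Module.End.eigenspace (toLin' M) 1) ≤ 1 :=
    (LinearMap.finrank_eigenspace_le _ 1).trans (by rwa [charpoly_toLin'])
  obtain ⟨e, he⟩ := finrank_le_one_iff.1 hdim
  have exists_smul_eq : ∀ z, M *ᵥ z = z → ∃ k : K, k • (e : n → K) = z := fun z hz =>
    (he ⟨z, by simpa [Module.End.mem_eigenspace_iff] using hz⟩).imp fun _ h =>
      congrArg Subtype.val h
  obtain ⟨α, rfl⟩ := exists_smul_eq x hMx
  obtain ⟨β, rfl⟩ := exists_smul_eq ψ hMψ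
  simp_all

lemma vecMul_inv_vecMul (hMψ : M *ᵥ ψ = ψ) (hφψ : φ ⬝ᵥ ψ ≠ 0) (hc : c ≠ 0)
    (hunit : IsUnit (M - 1 + c • vecMulVec ψ φ)) {x : n → K} (hx : x ⬝ᵥ ψ = 0) :
    (x ᵥ* (M - 1 + c • vecMulVec ψ φ)⁻¹) ᵥ* M = x ᵥ* (M - 1 + c • vecMulVec ψ φ)⁻¹ + x := by
  set A := M - 1 + c • vecMulVec ψ φ with hA
  set ζ := x ᵥ* A⁻¹
  have hζ : ζ ᵥ* A = x := by
    rw [vecMul_vecMul, nonsing_inv_mul _ ((isUnit_iff_isUnit_det A).1 hunit), vecMul_one]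
  have hAψ : A *ᵥ ψ = (c * (φ ⬝ᵥ ψ)) • ψ := by
    simp [hA, add_mulVec, sub_mulVec, hMψ, smul_mulVec, vecMulVec_mulVec, smul_smul]
  have hζψ : ζ ⬝ᵥ ψ = 0 := by
    rw [← hζ, ← dotProduct_mulVec, hAψ] at hx
    simpa [hc, hφψ] using hx
  rw [hA, vecMul_add, vecMul_sub, vecMul_one, vecMul_smul, vecMul_vecMulVec, hζψ] at hζ
  rw [← hζ]
  simp

end SimpleEigenvalue

/-! ### Smoothness of matrix inversion -/

section MatrixCalculus

variable {𝕜 R E ι : Type*} [NontriviallyNormedField 𝕜] [NormedAddCommGroup E] [NormedSpace 𝕜 E]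
  [Fintype ι] [DecidableEq ι] {n : WithTop ℕ∞}

section CommRing

variable [NormedCommRing R] [NormedAlgebra 𝕜 R] {A : E → Matrix ι ι R}

lemma contDiff_matrix_det (hA : ∀ i j, ContDiff 𝕜 n fun v => A v i j) :
    ContDiff 𝕜 n fun v => (A v).det := by
  simp only [det_apply']
  exact ContDiff.sum fun σ _ => contDiff_const.mul (contDiff_prod fun i _ => hA _ _)

lemma contDiff_matrix_adjugate (hA : ∀ i j, ContDiff 𝕜 n fun v => A v i j) (i j : ι) :
    ContDiff 𝕜 n fun v => (A v).adjugate i j := by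
  simp only [adjugate_apply]
  refine contDiff_matrix_det fun k l => ?_
  rcases eq_or_ne k j with rfl | h
  · simpa only [updateRow_self] using contDiff_const
  · simpa only [updateRow_ne h] using hA k l

end CommRing

lemma contDiff_matrix_inv [NormedField R] [NormedAlgebra 𝕜 R] {A : E → Matrix ι ι R}
    (hA : ∀ i j, ContDiff 𝕜 n fun v => A v i j) (hunit : ∀ v, IsUnit (A v)) (i j : ι) :
    ContDiff 𝕜 n fun v => (A v)⁻¹ i j := by
  simp only [inv_def, Matrix.smul_apply, Ring.inverse_eq_inv', smul_eq_mul]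
  exact ((contDiff_matrix_det hA).inv fun v =>
    ((isUnit_iff_isUnit_det _).1 (hunit v)).ne_zero).mul (contDiff_matrix_adjugate hA i j)

end MatrixCalculus

/-! ### Periodic functions on the torus -/

section Torus

variable {d : ℕ}

/-- Functions on `ℝ^d` that are `2π`-periodic in each coordinate, i.e. functions on `𝕋^d`. -/
def TorusPeriodic {α : Type*} (g : (Fin d → ℝ) → α) : Prop :=
  ∀ v (k : Fin d → ℤ), g (v + fun i => k i • (2 * Real.pi)) = g v

lemma existsUnique_add_period_mem_Ico (v : Fin d → ℝ) : ∃! k : Fin d → ℤ,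
    ∀ i, (v + fun i => k i • (2 * Real.pi)) i ∈ Set.Ico 0 (2 * Real.pi) := by
  choose k hk hk_unique using fun i =>
    existsUnique_add_zsmul_mem_Ico Real.two_pi_pos (v i) 0
  simp only [zero_add] at hk hk_unique
  exact ⟨k, hk, fun l hl => funext fun i => hk_unique i _ (hl i)⟩

lemma maxPoints_nonempty {g : (Fin d → ℝ) → ℝ} (hg : Continuous g) (hper : TorusPeriodic g) :
    (maxPoints g).Nonempty := by
  have hK : IsCompact (Set.Icc (0 : Fin d → ℝ) fun _ => 2 * Real.pi) := isCompact_Icc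
  obtain ⟨v, -, hv⟩ := hK.exists_isMaxOn ⟨0, le_rfl, fun _ => Real.two_pi_pos.le⟩ hg.continuousOn
  obtain ⟨k, hk, -⟩ := existsUnique_add_period_mem_Ico v
  refine ⟨_, hk, fun w => ?_⟩
  obtain ⟨l, hl, -⟩ := existsUnique_add_period_mem_Ico w
  rw [hper v k, ← hper w l]
  exact hv ⟨fun i => (hl i).1, fun i => (hl i).2.le⟩

end Torus

/-! ### The averaged coin operator -/

section SwapConj

variable {n R : Type*} [Fintype n] [DecidableEq n] [CommRing R] [StarRing R]

lemma star_inv_swap {A : Matrix (n × n) (n × n) R}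
    (hA : ∀ S T, star (A S.swap T.swap) = A S T) (S T : n × n) :
    star (A⁻¹ S.swap T.swap) = A⁻¹ S T := by
  have hA' : (A.submatrix (Equiv.prodComm n n) (Equiv.prodComm n n))ᴴᵀ = A := by
    ext S T
    exact hA S T
  conv_rhs => rw [← hA', ← transpose_nonsing_inv, ← conjTranspose_nonsing_inv,
    inv_submatrix_equiv]
  rfl

end SwapConj

section AveragedCoin

variable {d : ℕ}

/-- The vector `∑_τ |τ ⊗ τ⟩`. Pairing a coin correlation matrix with it computes its trace. -/
def diagVec (d : ℕ) : CoinIdx d × CoinIdx d → ℂ := fun T => if T.1 = T.2 then 1 else 0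

lemma dotProduct_diagVec (x : CoinIdx d × CoinIdx d → ℂ) : x ⬝ᵥ diagVec d = ∑ τ, x (τ, τ) := by
  simp [dotProduct, diagVec, Fintype.sum_prod_type]

lemma diagVec_dotProduct (x : CoinIdx d × CoinIdx d → ℂ) : diagVec d ⬝ᵥ x = ∑ τ, x (τ, τ) := by
  rw [dotProduct_comm, dotProduct_diagVec]

lemma diagVec_dotProduct_self : diagVec d ⬝ᵥ diagVec d = 2 * d := by
  simp [diagVec_dotProduct, diagVec, mul_comm]

lemma projP_eq_smul_vecMulVec :
    projP d = (1 / (2 * d) : ℂ) • vecMulVec (diagVec d) (diagVec d) := by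
  ext S T
  simp only [projP, diagVec, of_apply, Matrix.smul_apply, vecMulVec_apply, smul_eq_mul]
  split_ifs <;> simp_all

variable {Ω : Type*} [MeasurableSpace Ω] {μ : Measure Ω} {C : Ω → Coin d}
  {r : CoinIdx d → Fin d → ℤ}

/-- Entrywise measurability of the random coin. -/
def MeasurableCoin (C : Ω → Coin d) : Prop := ∀ τ σ, Measurable fun ω => (C ω).1 τ σ

/-- The eigenvalue `1` of `𝓜(-v, v)` is algebraically simple, for every `v`. Unlike
`AssumptionS`, this allows further eigenvalues on the unit circle. -/
def SimpleEigenvalueOne (μ : Measure Ω) (C : Ω → Coin d) (r : CoinIdx d → Fin d → ℤ) : Prop :=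
  ∀ v, (avgM μ C r (-v) v).charpoly.rootMultiplicity 1 = 1

lemma SimpleEigenvalueOne.ne_zero (h : SimpleEigenvalueOne μ C r) : d ≠ 0 := by
  rintro rfl
  simpa [Matrix.charpoly, Polynomial.rootMultiplicity_eq_zero] using h 0

lemma star_avgM_swap (v : Fin d → ℝ) (S T : CoinIdx d × CoinIdx d) :
    star (avgM μ C r (-v) v S.swap T.swap) = avgM μ C r (-v) v S T := by
  simp only [avgM, phase, diagonal_mul, meanTensor, of_apply, star_mul', Prod.fst_swap,
    Prod.snd_swap]
  congr 1
  · rw [Complex.star_def, ← Complex.exp_conj]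
    congr 1
    simp only [map_mul, Complex.conj_I, Complex.conj_ofReal, neg_dotProduct]
    push_cast
    ring
  · rw [Complex.star_def, ← integral_conj]
    simp [mul_comm]

lemma star_projP_swap (S T : CoinIdx d × CoinIdx d) :
    star (projP d S.swap T.swap) = projP d S T := by
  simp only [projP, of_apply, Prod.fst_swap, Prod.snd_swap, eq_comm (a := S.2),
    eq_comm (a := T.2)]
  split_ifs <;> simp

lemma star_redResolvent_swap (v : Fin d → ℝ) (S T : CoinIdx d × CoinIdx d) :
    star (redResolvent μ C r v S.swap T.swap) = redResolvent μ C r v S T := by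
  rw [redResolvent, Matrix.sub_apply, Matrix.sub_apply, star_sub, star_projP_swap]
  congr 1
  refine star_inv_swap (fun S T => ?_) S T
  simp only [Matrix.add_apply, Matrix.sub_apply, star_add, star_sub, star_avgM_swap,
    star_projP_swap]
  simp [one_apply, Prod.swap_inj, apply_ite]

lemma ofReal_re_redResolvent_diag (v : Fin d → ℝ) (τ σ : CoinIdx d) :
    ((redResolvent μ C r v (τ, τ) (σ, σ)).re : ℂ) = redResolvent μ C r v (τ, τ) (σ, σ) :=
  Complex.conj_eq_iff_re.1 (star_redResolvent_swap v (τ, τ) (σ, σ))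

lemma phase_mulVec_diagVec (v : Fin d → ℝ) : phase r (-v) v *ᵥ diagVec d = diagVec d := by
  ext ⟨τ, σ⟩
  rw [phase, mulVec_diagonal]
  rcases eq_or_ne τ σ with rfl | h <;> simp [diagVec, *]

lemma diagVec_vecMul_phase (v : Fin d → ℝ) : diagVec d ᵥ* phase r (-v) v = diagVec d := by
  ext ⟨τ, σ⟩
  rw [phase, vecMul_diagonal]
  rcases eq_or_ne τ σ with rfl | h <;> simp [diagVec, *]

variable [IsProbabilityMeasure μ]

lemma MeasurableCoin.integrable_mul_star (hC : MeasurableCoin C) (τ σ τ' σ' : CoinIdx d) :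
    Integrable (fun ω => (C ω).1 τ σ * star ((C ω).1 τ' σ')) μ := by
  refine .of_bound ((hC _ _).mul (continuous_star.measurable.comp (hC _ _))).aestronglyMeasurable 1
    (ae_of_all _ fun ω => ?_)
  rw [norm_mul, norm_star]
  exact mul_le_one₀ (entry_norm_bound_of_unitary (C ω).2 _ _) (norm_nonneg _)
    (entry_norm_bound_of_unitary (C ω).2 _ _)

lemma meanTensor_mulVec_diagVec (hC : MeasurableCoin C) :
    meanTensor μ C *ᵥ diagVec d = diagVec d := by
  ext S
  have unitary : ∀ ω, ∑ τ, (C ω).1 S.1 τ * star ((C ω).1 S.2 τ) = diagVec d S := fun ω => by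
    simpa [mul_apply, star_apply, one_apply, diagVec] using
      congrFun (congrFun (mem_unitaryGroup_iff.1 (C ω).2) S.1) S.2
  rw [mulVec, dotProduct_diagVec]
  simp only [meanTensor, of_apply]
  rw [← integral_finsetSum _ fun τ _ => hC.integrable_mul_star _ _ _ _]
  simp only [unitary, integral_const, probReal_univ, one_smul]

lemma diagVec_vecMul_meanTensor (hC : MeasurableCoin C) :
    diagVec d ᵥ* meanTensor μ C = diagVec d := by
  ext T
  have unitary : ∀ ω, ∑ τ, (C ω).1 τ T.1 * star ((C ω).1 τ T.2) = diagVec d T := fun ω => by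
    simpa [mul_apply, star_apply, one_apply, diagVec, mul_comm, eq_comm] using
      congrFun (congrFun (mem_unitaryGroup_iff'.1 (C ω).2) T.2) T.1
  rw [vecMul, diagVec_dotProduct]
  simp only [meanTensor, of_apply]
  rw [← integral_finsetSum _ fun τ _ => hC.integrable_mul_star _ _ _ _]
  simp only [unitary, integral_const, probReal_univ, one_smul]

lemma avgM_mulVec_diagVec (hC : MeasurableCoin C) (v : Fin d → ℝ) :
    avgM μ C r (-v) v *ᵥ diagVec d = diagVec d := by
  rw [avgM, ← mulVec_mulVec, meanTensor_mulVec_diagVec hC, phase_mulVec_diagVec]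

lemma diagVec_vecMul_avgM (hC : MeasurableCoin C) (v : Fin d → ℝ) :
    diagVec d ᵥ* avgM μ C r (-v) v = diagVec d := by
  rw [avgM, ← vecMul_vecMul, diagVec_vecMul_phase, diagVec_vecMul_meanTensor hC]

lemma isUnit_avgM_sub_one_add_projP (hC : MeasurableCoin C) (hS : SimpleEigenvalueOne μ C r)
    (v : Fin d → ℝ) : IsUnit (avgM μ C r (-v) v - 1 + projP d) := by
  have hd := hS.ne_zero
  rw [projP_eq_smul_vecMulVec]
  exact isUnit_sub_one_add_smul_vecMulVec (avgM_mulVec_diagVec hC v) (diagVec_vecMul_avgM hC v)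
    (by simpa [diagVec_dotProduct_self] using hd) (by simpa using hd) (hS v).le

lemma vecMul_redResolvent_vecMul_avgM (hC : MeasurableCoin C) (hS : SimpleEigenvalueOne μ C r)
    (v : Fin d → ℝ) {x : CoinIdx d × CoinIdx d → ℂ} (hx : ∑ τ, x (τ, τ) = 0) :
    (x ᵥ* redResolvent μ C r v) ᵥ* avgM μ C r (-v) v = x ᵥ* redResolvent μ C r v + x := by
  have hd := hS.ne_zero
  rw [← dotProduct_diagVec] at hx
  have hxP : x ᵥ* redResolvent μ C r v = x ᵥ* (avgM μ C r (-v) v - 1 + projP d)⁻¹ := by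
    rw [redResolvent, vecMul_sub, sub_eq_self, projP_eq_smul_vecMulVec, vecMul_smul,
      vecMul_vecMulVec, hx, zero_smul, smul_zero]
  have hunit := isUnit_avgM_sub_one_add_projP hC hS v
  rw [projP_eq_smul_vecMulVec] at hxP hunit
  rw [hxP]
  exact vecMul_inv_vecMul (avgM_mulVec_diagVec hC v)
    (by simpa [diagVec_dotProduct_self] using hd) (by simpa using hd) hunit hx

end AveragedCoin

/-! ### The quadratic form of the diffusion matrix -/

section Diffusion

variable {d : ℕ} {Ω : Type*} [MeasurableSpace Ω] {μ : Measure Ω} {C : Ω → Coin d}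
  {r : CoinIdx d → Fin d → ℤ}

/-- The centred jump `ρ(τ) = r(τ) - r̄`. -/
def centredJump (r : CoinIdx d → Fin d → ℤ) (τ : CoinIdx d) : Fin d → ℝ :=
  fun i => r τ i - meanJump r i

lemma sum_dotProduct_centredJump (y : Fin d → ℝ) : ∑ τ, y ⬝ᵥ centredJump r τ = 0 := by
  rw [← dotProduct_sum]
  refine Eq.trans (congrArg _ (funext fun i => ?_)) (dotProduct_zero y)
  have hd : (d : ℝ) ≠ 0 := Nat.cast_ne_zero.2 (Fin.pos i).ne'
  simp only [Finset.sum_apply, centredJump, meanJump, Finset.sum_sub_distrib, Finset.sum_const,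
    Finset.card_univ, Fintype.card_prod, Fintype.card_fin, Fintype.card_units_int, nsmul_eq_mul,
    Pi.zero_apply]
  push_cast
  field_simp
  ring

lemma diffusion_eq_sum_vecMulVec (v : Fin d → ℝ) :
    diffusion μ C r v =
      -(1 / (2 * d : ℝ)) • ∑ τ, vecMulVec (centredJump r τ) (centredJump r τ)
        - (1 / (2 * d : ℝ)) • ∑ τ, ∑ τ', (redResolvent μ C r v (τ, τ) (τ', τ')).re •
          (vecMulVec (centredJump r τ) (centredJump r τ') +
            vecMulVec (centredJump r τ') (centredJump r τ)) := by
  ext j k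
  simp only [diffusion, centredJump, of_apply, Matrix.sub_apply, Matrix.smul_apply,
    Matrix.sum_apply, Matrix.add_apply, vecMulVec_apply, smul_eq_mul]
  refine congrArg _ (congrArg _ (Finset.sum_congr rfl fun τ _ =>
    Finset.sum_congr rfl fun τ' _ => ?_))
  ring

lemma quad_eq (y v : Fin d → ℝ) :
    quad μ C r y v = -(1 / (2 * d : ℝ)) * ∑ τ, (y ⬝ᵥ centredJump r τ) ^ 2
      - (1 / d : ℝ) * ∑ τ, ∑ τ', (y ⬝ᵥ centredJump r τ) * (y ⬝ᵥ centredJump r τ') *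
          (redResolvent μ C r v (τ, τ) (τ', τ')).re := by
  rw [quad, diffusion_eq_sum_vecMulVec]
  simp only [sub_mulVec, smul_mulVec, sum_mulVec, add_mulVec, vecMulVec_mulVec, dotProduct_sub,
    dotProduct_smul, dotProduct_sum, dotProduct_add, op_smul_eq_smul, smul_eq_mul,
    dotProduct_comm _ y]
  congr 1
  · simp only [sq]
  · simp only [Finset.mul_sum]
    congr! 2
    ring

lemma quad_smul (c : ℝ) (y v : Fin d → ℝ) : quad μ C r (c • y) v = c ^ 2 * quad μ C r y v := by
  simp only [quad, mulVec_smul, dotProduct_smul, smul_dotProduct, smul_eq_mul]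
  ring

lemma torusPeriodic_avgM : TorusPeriodic fun v => avgM μ C r (-v) v := by
  intro v k
  simp only [avgM, phase]
  congr 2
  ext T
  rw [Complex.exp_eq_exp_iff_exists_int]
  refine ⟨∑ i, (k i * r T.2 i - k i * r T.1 i), ?_⟩
  simp only [dotProduct, ← Finset.sum_add_distrib, Pi.neg_apply, Pi.add_apply, zsmul_eq_mul]
  push_cast
  rw [Finset.mul_sum, Finset.mul_sum, Finset.sum_mul, ← Finset.sum_add_distrib]
  exact Finset.sum_congr rfl fun i _ => by ring

lemma torusPeriodic_quad (y : Fin d → ℝ) : TorusPeriodic (quad μ C r y) := by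
  intro v k
  simp only [quad, diffusion, redResolvent, torusPeriodic_avgM v k]

lemma contDiff_avgM {n : WithTop ℕ∞} (S T : CoinIdx d × CoinIdx d) :
    ContDiff ℝ n fun v => avgM μ C r (-v) v S T := by
  simp only [avgM, phase, diagonal_mul, dotProduct, Pi.neg_apply]
  refine ContDiff.mul (Complex.contDiff_exp.comp (contDiff_const.mul
    (Complex.ofRealCLM.contDiff.comp (ContDiff.add ?_ ?_)))) contDiff_const <;> fun_prop

variable [IsProbabilityMeasure μ]

lemma contDiff_redResolvent (hC : MeasurableCoin C) (hS : SimpleEigenvalueOne μ C r)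
    {n : WithTop ℕ∞} (S T : CoinIdx d × CoinIdx d) :
    ContDiff ℝ n fun v => redResolvent μ C r v S T :=
  (contDiff_matrix_inv (fun S T => ((contDiff_avgM S T).sub contDiff_const).add contDiff_const)
    (isUnit_avgM_sub_one_add_projP hC hS) S T).sub contDiff_const

lemma contDiff_quad (hC : MeasurableCoin C) (hS : SimpleEigenvalueOne μ C r)
    {n : WithTop ℕ∞} :
    ContDiff ℝ n fun p : (Fin d → ℝ) × (Fin d → ℝ) => quad μ C r p.1 p.2 := by
  have hre : ∀ τ τ' : CoinIdx d, ContDiff ℝ n fun p : (Fin d → ℝ) × (Fin d → ℝ) =>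
      (redResolvent μ C r p.2 (τ, τ) (τ', τ')).re := fun τ τ' =>
    Complex.reCLM.contDiff.comp ((contDiff_redResolvent hC hS _ _).comp contDiff_snd)
  simp only [quad_eq, dotProduct]
  fun_prop

end Diffusion

/-! ### Second-order perturbation of the left eigenvector -/

section Perturbation

open Asymptotics

lemma isBigO_exp_neg_mul_sub_taylor {X : Type*} {𝓕 : Filter X} {t R : X → ℂ}
    (ht : Tendsto t 𝓕 (𝓝 0)) (hR : R =O[𝓕] (1 : X → ℂ)) (k : ℕ) :
    (fun x => Complex.exp (-(t x * R x)) -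
      ∑ i ∈ Finset.range k, (-(t x * R x)) ^ i / i.factorial) =O[𝓕] fun x => t x ^ k := by
  have hu : (fun x => -(t x * R x)) =O[𝓕] t := by
    simpa using ((isBigO_refl t 𝓕).mul hR).neg_left
  exact ((Complex.exp_sub_sum_range_isBigO_pow k).comp_tendsto (hu.trans_tendsto ht)).trans
    (hu.pow k)

section ScalarEstimates

variable {X : Type*} {𝓕 : Filter X} {t R p l ζ₁ ζ₂ : X → ℂ}

lemma isBigO_perturbed_sub (ht : Tendsto t 𝓕 (𝓝 0)) (hR : R =O[𝓕] (1 : X → ℂ))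
    (hp : p =O[𝓕] (1 : X → ℂ)) (hζ₁ : ζ₁ =O[𝓕] (1 : X → ℂ)) (hζ₂ : ζ₂ =O[𝓕] (1 : X → ℂ)) :
    (fun x => (p x + t x * ζ₁ x + t x ^ 2 * ζ₂ x) * Complex.exp (-(t x * R x)) - p x)
      =O[𝓕] t := by
  have exp₀ := isBigO_exp_neg_mul_sub_taylor ht hR 0
  have exp₁ := isBigO_exp_neg_mul_sub_taylor ht hR 1
  have h₀ := hp.mul exp₁
  have h₁ := ((isBigO_refl t 𝓕).mul hζ₁).mul exp₀
  have h₂ := (((isBigO_refl t 𝓕).mul (ht.isBigO_one ℂ)).mul hζ₂).mul exp₀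
  simp only [Pi.one_apply, one_mul, mul_one, pow_one, pow_zero] at h₀ h₁ h₂
  refine ((h₀.add h₁).add h₂).congr_left fun x => ?_
  simp only [Finset.sum_range_succ, Finset.range_zero, Finset.sum_empty, Nat.factorial, pow_zero]
  push_cast
  ring

lemma isBigO_perturbation_residual (ht : Tendsto t 𝓕 (𝓝 0)) (hR : R =O[𝓕] (1 : X → ℂ))
    (hp : p =O[𝓕] (1 : X → ℂ)) (hζ₁ : ζ₁ =O[𝓕] (1 : X → ℂ)) (hζ₂ : ζ₂ =O[𝓕] (1 : X → ℂ))
    (hl : l =O[𝓕] (1 : X → ℂ)) :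
    (fun x => p x + t x * (ζ₁ x - p x * R x) +
        t x ^ 2 * (ζ₂ x + (l x * p x - (ζ₁ x * R x - 1 / 2 * (p x * R x ^ 2)))) -
      (1 + t x ^ 2 * l x) * ((p x + t x * ζ₁ x + t x ^ 2 * ζ₂ x) * Complex.exp (-(t x * R x))))
      =O[𝓕] fun x => t x ^ 3 := by
  have hexp := isBigO_exp_neg_mul_sub_taylor ht hR
  have h₀ := hp.mul (hexp 3)
  have h₁ := ((isBigO_refl t 𝓕).mul hζ₁).mul (hexp 2)
  have h₂ := (((isBigO_refl t 𝓕).pow 2).mul hζ₂).mul (hexp 1)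
  have h₃ := (((isBigO_refl t 𝓕).pow 2).mul hl).mul (isBigO_perturbed_sub ht hR hp hζ₁ hζ₂)
  simp only [Pi.one_apply, one_mul, mul_one, pow_one, ← pow_succ, ← pow_succ',
    Nat.reduceAdd] at h₀ h₁ h₂ h₃
  refine (((h₀.add h₁).add h₂).add h₃).neg_left.congr_left fun x => ?_
  simp only [Finset.sum_range_succ, Finset.range_zero, Finset.sum_empty, Nat.factorial, pow_zero]
  push_cast
  ring

end ScalarEstimates

variable {d : ℕ} {Ω : Type*} [MeasurableSpace Ω] {μ : Measure Ω} {C : Ω → Coin d}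
  {r : CoinIdx d → Fin d → ℤ}

/-- The symmetrised centred jump `(y · ρ(τ) + y · ρ(τ')) / 2`, whose exponential is the weight
that an exponential tilt gives to the coin correlation at `τ ⊗ τ'`. -/
def pairJump (r : CoinIdx d → Fin d → ℤ) (y : Fin d → ℝ)
    (T : CoinIdx d × CoinIdx d) : ℝ :=
  (y ⬝ᵥ centredJump r T.1 + y ⬝ᵥ centredJump r T.2) / 2

lemma pairJump_diag (y : Fin d → ℝ) (τ : CoinIdx d) :
    pairJump r y (τ, τ) = y ⬝ᵥ centredJump r τ := by
  simp [pairJump]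

/-- The right-hand side of the equation `ζ₁ (𝓜(-v,v) - 1) = x₁` for the first-order correction
of the left eigenvector `∑_τ ⟨τ ⊗ τ|` under a tilt in the direction `y`. -/
def source₁ (r : CoinIdx d → Fin d → ℤ) (y : Fin d → ℝ) :
    CoinIdx d × CoinIdx d → ℂ :=
  fun T => -(diagVec d T * pairJump r y T)

/-- The first-order correction `ζ₁` of the left eigenvector. -/
def correction₁ (μ : Measure Ω) (C : Ω → Coin d) (r : CoinIdx d → Fin d → ℤ)
    (y v : Fin d → ℝ) : CoinIdx d × CoinIdx d → ℂ :=
  source₁ r y ᵥ* redResolvent μ C r v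

/-- The right-hand side of the equation `ζ₂ (𝓜(-v,v) - 1) = x₂` for the second-order correction
of the left eigenvector; `⟨y, 𝔻(v) y⟩ / 2` is the second-order term of the eigenvalue. -/
def source₂ (μ : Measure Ω) (C : Ω → Coin d) (r : CoinIdx d → Fin d → ℤ)
    (y v : Fin d → ℝ) : CoinIdx d × CoinIdx d → ℂ :=
  fun T => ((quad μ C r y v / 2 : ℝ) : ℂ) * diagVec d T -
    (correction₁ μ C r y v T * pairJump r y T - 1 / 2 * (diagVec d T * pairJump r y T ^ 2))

/-- The second-order correction `ζ₂` of the left eigenvector. -/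
def correction₂ (μ : Measure Ω) (C : Ω → Coin d) (r : CoinIdx d → Fin d → ℤ)
    (y v : Fin d → ℝ) : CoinIdx d × CoinIdx d → ℂ :=
  source₂ μ C r y v ᵥ* redResolvent μ C r v

/-- The approximate left eigenvector of the operator `e^{t R} 𝓜(-v,v)` with `R = pairJump r y`,
to second order in `t`. The factor `e^{-t R}` undoes the tilt, so that `𝓜(-v,v)` acts on a
polynomial in `t`. -/
def approxLeftEigenvector (μ : Measure Ω) (C : Ω → Coin d)
    (r : CoinIdx d → Fin d → ℤ) (y : Fin d → ℝ) (t : ℝ) (v : Fin d → ℝ) :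
    CoinIdx d × CoinIdx d → ℂ :=
  fun T => (diagVec d T + t * correction₁ μ C r y v T + t ^ 2 * correction₂ μ C r y v T) *
    Complex.exp (-(t * pairJump r y T))

/-- The tilted operator `e^{t R} 𝓜(-v,v)` with `R = pairJump r y`. -/
def tiltedM (μ : Measure Ω) (C : Ω → Coin d) (r : CoinIdx d → Fin d → ℤ)
    (y : Fin d → ℝ) (t : ℝ) (v : Fin d → ℝ) :
    Matrix (CoinIdx d × CoinIdx d) (CoinIdx d × CoinIdx d) ℂ :=
  diagonal (fun T => Complex.exp (t * pairJump r y T)) * avgM μ C r (-v) v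

lemma sum_source₁_diag (y : Fin d → ℝ) : ∑ τ, source₁ r y (τ, τ) = 0 := by
  simp only [source₁, pairJump_diag, diagVec, if_true, one_mul, Finset.sum_neg_distrib]
  rw [← Complex.ofReal_sum, sum_dotProduct_centredJump, Complex.ofReal_zero, neg_zero]

lemma correction₁_diag (y v : Fin d → ℝ) (τ : CoinIdx d) :
    correction₁ μ C r y v (τ, τ) =
      -∑ σ, (y ⬝ᵥ centredJump r σ) * ((redResolvent μ C r v (σ, σ) (τ, τ)).re : ℂ) := by
  calc correction₁ μ C r y v (τ, τ)
      = -(diagVec d ⬝ᵥ fun S => pairJump r y S * redResolvent μ C r v S (τ, τ)) := by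
        simp only [correction₁, source₁, vecMul, dotProduct, neg_mul, mul_assoc,
          Finset.sum_neg_distrib]
    _ = _ := by simp only [diagVec_dotProduct, pairJump_diag, ofReal_re_redResolvent_diag]

/-- The diffusion matrix is exactly what makes the second-order equation solvable. -/
lemma sum_source₂_diag (y v : Fin d → ℝ) : ∑ τ, source₂ μ C r y v (τ, τ) = 0 := by
  rcases eq_or_ne d 0 with rfl | hd
  · simp
  have hsum : ∑ τ, ∑ σ, (y ⬝ᵥ centredJump r σ) * (redResolvent μ C r v (σ, σ) (τ, τ)).re *
      (y ⬝ᵥ centredJump r τ) = ∑ τ, ∑ σ, (y ⬝ᵥ centredJump r τ) * (y ⬝ᵥ centredJump r σ) *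
        (redResolvent μ C r v (τ, τ) (σ, σ)).re := by
    rw [Finset.sum_comm]
    exact Finset.sum_congr rfl fun τ _ => Finset.sum_congr rfl fun σ _ => by ring
  have hreal : ∀ τ, source₂ μ C r y v (τ, τ) = ((quad μ C r y v / 2 +
      (∑ σ, (y ⬝ᵥ centredJump r σ) * (redResolvent μ C r v (σ, σ) (τ, τ)).re *
        (y ⬝ᵥ centredJump r τ) + 1 / 2 * (y ⬝ᵥ centredJump r τ) ^ 2) : ℝ) : ℂ) := fun τ => by
    simp only [source₂, correction₁_diag, pairJump_diag, diagVec, if_true, ← Finset.sum_mul]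
    push_cast
    ring
  simp only [hreal]
  rw [← Complex.ofReal_sum, Complex.ofReal_eq_zero, Finset.sum_add_distrib,
    Finset.sum_add_distrib, hsum, ← Finset.mul_sum, quad_eq]
  simp only [Finset.sum_const, Finset.card_univ, Fintype.card_prod, Fintype.card_fin,
    Fintype.card_units_int, nsmul_eq_mul]
  push_cast
  field_simp
  ring

variable [IsProbabilityMeasure μ]

lemma approxLeftEigenvector_vecMul_tiltedM (hC : MeasurableCoin C)
    (hS : SimpleEigenvalueOne μ C r) (y : Fin d → ℝ) (t : ℝ) (v : Fin d → ℝ) :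
    approxLeftEigenvector μ C r y t v ᵥ* tiltedM μ C r y t v =
      diagVec d + (t : ℂ) • (correction₁ μ C r y v + source₁ r y) +
        (t : ℂ) ^ 2 • (correction₂ μ C r y v + source₂ μ C r y v) := by
  have htilt : approxLeftEigenvector μ C r y t v ᵥ*
      diagonal (fun T => Complex.exp (t * pairJump r y T)) =
      diagVec d + (t : ℂ) • correction₁ μ C r y v + (t : ℂ) ^ 2 • correction₂ μ C r y v := by
    ext T
    rw [vecMul_diagonal, approxLeftEigenvector, mul_assoc, ← Complex.exp_add, neg_add_cancel,
      Complex.exp_zero, mul_one]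
    rfl
  rw [tiltedM, ← vecMul_vecMul, htilt, add_vecMul, add_vecMul, smul_vecMul, smul_vecMul,
    diagVec_vecMul_avgM hC, correction₁, correction₂,
    vecMul_redResolvent_vecMul_avgM hC hS v (sum_source₁_diag y),
    vecMul_redResolvent_vecMul_avgM hC hS v (sum_source₂_diag y v)]

lemma continuous_correction₁ (hC : MeasurableCoin C) (hS : SimpleEigenvalueOne μ C r)
    (y : Fin d → ℝ) (T : CoinIdx d × CoinIdx d) :
    Continuous fun v => correction₁ μ C r y v T :=
  continuous_finsetSum _ fun S _ =>
    continuous_const.mul (contDiff_redResolvent hC hS (n := 0) S T).continuous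

lemma continuous_quad (hC : MeasurableCoin C) (hS : SimpleEigenvalueOne μ C r) (y : Fin d → ℝ) :
    Continuous (quad μ C r y) :=
  (contDiff_quad hC hS (n := 0)).continuous.comp (Continuous.prodMk_right y)

lemma continuous_correction₂ (hC : MeasurableCoin C) (hS : SimpleEigenvalueOne μ C r)
    (y : Fin d → ℝ) (T : CoinIdx d × CoinIdx d) :
    Continuous fun v => correction₂ μ C r y v T := by
  refine continuous_finsetSum _ fun S _ =>
    Continuous.mul ?_ (contDiff_redResolvent hC hS (n := 0) S T).continuous
  have hquad := continuous_quad hC hS y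
  have hζ := continuous_correction₁ hC hS y S
  unfold source₂
  fun_prop

/-- The closed fundamental domain `[0, 2π]^d` of the torus. -/
def torusBox (d : ℕ) : Set (Fin d → ℝ) := Set.Icc 0 fun _ => 2 * Real.pi

lemma isBigO_one_of_continuous {E : Type*} {K : Set E} [TopologicalSpace E] (hK : IsCompact K)
    {f : E → ℂ} (hf : Continuous f) :
    (fun p : ℝ × E => f p.2) =O[𝓝 0 ×ˢ 𝓟 K] (1 : ℝ × E → ℂ) :=
  (hf.continuousOn.isBigO_principal hK (c := (1 : ℂ)) (by simp)).comp_tendsto tendsto_snd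

lemma isBigO_approxLeftEigenvector (hC : MeasurableCoin C) (hS : SimpleEigenvalueOne μ C r)
    (y : Fin d → ℝ) (T : CoinIdx d × CoinIdx d) :
    (fun p : ℝ × (Fin d → ℝ) => approxLeftEigenvector μ C r y p.1 p.2 T - diagVec d T)
        =O[𝓝 0 ×ˢ 𝓟 (torusBox d)] (fun p => (p.1 : ℂ)) ∧
      (fun p : ℝ × (Fin d → ℝ) =>
        (approxLeftEigenvector μ C r y p.1 p.2 ᵥ* tiltedM μ C r y p.1 p.2) T -
          (1 + p.1 ^ 2 * (quad μ C r y p.2 / 2) : ℝ) * approxLeftEigenvector μ C r y p.1 p.2 T)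
        =O[𝓝 0 ×ˢ 𝓟 (torusBox d)] (fun p => (p.1 : ℂ) ^ 3) := by
  have hbdd := fun {f : (Fin d → ℝ) → ℂ} (hf : Continuous f) =>
    isBigO_one_of_continuous (K := torusBox d) isCompact_Icc hf
  have ht : Tendsto (fun p : ℝ × (Fin d → ℝ) => (p.1 : ℂ)) (𝓝 0 ×ˢ 𝓟 (torusBox d)) (𝓝 0) :=
    (Complex.continuous_ofReal.tendsto' 0 0 Complex.ofReal_zero).comp tendsto_fst
  have hR := hbdd (continuous_const (y := (pairJump r y T : ℂ)))
  have hp := hbdd (continuous_const (y := diagVec d T))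
  have hζ₁ := hbdd (continuous_correction₁ hC hS y T)
  have hζ₂ := hbdd (continuous_correction₂ hC hS y T)
  have hl := hbdd (Complex.continuous_ofReal.comp ((continuous_quad hC hS y).div_const 2))
  refine ⟨isBigO_perturbed_sub ht hR hp hζ₁ hζ₂,
    (isBigO_perturbation_residual ht hR hp hζ₁ hζ₂ hl).congr_left fun q => ?_⟩
  rw [approxLeftEigenvector_vecMul_tiltedM hC hS]
  simp only [approxLeftEigenvector, source₁, source₂, Pi.add_apply, Pi.smul_apply, smul_eq_mul,
    Function.comp_apply]
  push_cast
  ring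

end Perturbation

/-! ### Plancherel's identity on the torus -/

section Torus

open scoped ProbabilityTheory

variable {d : ℕ}

lemma isProbabilityMeasure_cond_Ioc_two_pi :
    IsProbabilityMeasure (volume[|Set.Ioc 0 (2 * Real.pi)] : Measure ℝ) :=
  ProbabilityTheory.cond_isProbabilityMeasure_of_finite (by simp [Real.pi_pos])
    measure_Ioc_lt_top.ne

/-- The uniform probability measure on the fundamental domain `(0, 2π]^d` of the torus. -/
def torusMeasure (d : ℕ) : Measure (Fin d → ℝ) :=
  Measure.pi fun _ => volume[|Set.Ioc 0 (2 * Real.pi)]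

instance : IsProbabilityMeasure (torusMeasure d) :=
  have := isProbabilityMeasure_cond_Ioc_two_pi
  inferInstanceAs (IsProbabilityMeasure (Measure.pi _))

/-- The character `v ↦ exp (-i v · k)` of the torus. -/
def torusChar (k : Fin d → ℤ) (v : Fin d → ℝ) : ℂ :=
  Complex.exp (-(Complex.I * (v ⬝ᵥ fun i => (k i : ℝ) : ℝ)))

lemma torusChar_add (k l : Fin d → ℤ) (v : Fin d → ℝ) :
    torusChar (k + l) v = torusChar k v * torusChar l v := by
  rw [torusChar, torusChar, torusChar, ← Complex.exp_add, ← neg_add, ← mul_add,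
    ← Complex.ofReal_add, ← dotProduct_add]
  congr! with i
  simp

lemma torusChar_neg (k : Fin d → ℤ) (v : Fin d → ℝ) : torusChar (-k) v = star (torusChar k v) := by
  have : (v ⬝ᵥ fun i => (((-k) i : ℤ) : ℝ)) = -(v ⬝ᵥ fun i => (k i : ℝ)) := by
    simp [← dotProduct_neg, Pi.neg_def]
  rw [torusChar, torusChar, Complex.star_def, ← Complex.exp_conj, this]
  simp

lemma norm_torusChar (k : Fin d → ℤ) (v : Fin d → ℝ) : ‖torusChar k v‖ = 1 := by
  simp [torusChar, Complex.norm_exp]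

lemma continuous_torusChar (k : Fin d → ℤ) : Continuous (torusChar k) := by
  unfold torusChar dotProduct
  fun_prop

lemma integrable_torusChar (k : Fin d → ℤ) : Integrable (torusChar k) (torusMeasure d) :=
  .of_bound (continuous_torusChar k).aestronglyMeasurable 1
    (ae_of_all _ fun v => (norm_torusChar k v).le)

lemma integral_exp_neg_I_mul_int (k : ℤ) :
    ∫ x : ℝ, Complex.exp (-(Complex.I * (x * k : ℝ))) ∂volume[|Set.Ioc 0 (2 * Real.pi)]
      = if k = 0 then 1 else 0 := by
  have := isProbabilityMeasure_cond_Ioc_two_pi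
  split_ifs with hk
  · simp [hk]
  · have hc : (-(Complex.I * k) : ℂ) ≠ 0 := by simp [hk]
    have hperiod : Complex.exp (-(Complex.I * k) * ((2 * Real.pi : ℝ) : ℂ)) = 1 :=
      Complex.exp_eq_one_iff.2 ⟨-k, by push_cast; ring⟩
    calc _ = ∫ x : ℝ, Complex.exp (-(Complex.I * k) * x) ∂volume[|Set.Ioc 0 (2 * Real.pi)] := by
          congr! 3 with x
          push_cast
          ring
      _ = 0 := by
          rw [ProbabilityTheory.cond, integral_smul_measure,
            ← intervalIntegral.integral_of_le Real.two_pi_pos.le, integral_exp_mul_complex hc,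
            hperiod]
          simp

lemma integral_torusChar (k : Fin d → ℤ) :
    ∫ v, torusChar k v ∂torusMeasure d = if k = 0 then 1 else 0 := by
  have := isProbabilityMeasure_cond_Ioc_two_pi
  have hprod : ∀ v : Fin d → ℝ,
      torusChar k v = ∏ i, Complex.exp (-(Complex.I * (v i * k i : ℝ))) := fun v => by
    rw [← Complex.exp_sum, torusChar, dotProduct, Complex.ofReal_sum, Finset.mul_sum,
      Finset.sum_neg_distrib]
  simp only [hprod, torusMeasure]
  rw [integral_fintype_prod_eq_prod fun i x => Complex.exp (-(Complex.I * (x * k i : ℝ)))]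
  simp only [integral_exp_neg_I_mul_int, Finset.prod_ite_zero, Finset.prod_const_one, funext_iff,
    Finset.mem_univ, true_imp_iff, Pi.zero_apply]

lemma integral_norm_sq_sum_torusChar (s : Finset (Fin d → ℤ)) (c : (Fin d → ℤ) → ℂ) :
    ∫ v, ‖∑ k ∈ s, torusChar k v * c k‖ ^ 2 ∂torusMeasure d = ∑ k ∈ s, ‖c k‖ ^ 2 := by
  have hexpand : ∀ v, ((‖∑ k ∈ s, torusChar k v * c k‖ ^ 2 : ℝ) : ℂ) =
      ∑ k ∈ s, ∑ l ∈ s, torusChar (k - l) v * (c k * star (c l)) := fun v => by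
    rw [Complex.ofReal_pow, ← Complex.mul_conj', ← Complex.star_def, star_sum,
      Finset.sum_mul_sum]
    refine Finset.sum_congr rfl fun k _ => Finset.sum_congr rfl fun l _ => ?_
    rw [star_mul', mul_mul_mul_comm, sub_eq_add_neg, torusChar_add, torusChar_neg]
  have hint : ∀ k l, Integrable (fun v => torusChar (k - l) v * (c k * star (c l)))
      (torusMeasure d) := fun k l => (integrable_torusChar _).mul_const _
  rw [← Complex.ofReal_inj, ← integral_complex_ofReal, Complex.ofReal_sum]
  simp only [hexpand]
  rw [integral_finsetSum _ fun k _ => integrable_finsetSum _ fun l _ => hint k l]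
  refine Finset.sum_congr rfl fun k hk => ?_
  rw [integral_finsetSum _ fun l _ => hint k l]
  simp only [integral_mul_const, integral_torusChar, sub_eq_zero, ite_mul, one_mul, zero_mul,
    Finset.sum_ite_eq, hk, if_true]
  rw [Complex.star_def, Complex.mul_conj', Complex.ofReal_pow]

end Torus

/-! ### Coin correlations of the tilted walk -/

section Walk

variable {d : ℕ} {r : CoinIdx d → Fin d → ℤ} {φ₀ : CoinIdx d → ℂ} {Cs Cs' : ℕ → Coin d} {n : ℕ}

lemma norm_coin_mulVec_le (U : Coin d) (f : CoinIdx d → ℂ) : ‖U.1 *ᵥ f‖ ≤ 2 * d * ‖f‖ := by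
  refine (pi_norm_le_iff_of_nonneg (by positivity)).2 fun τ => ?_
  calc ‖∑ σ, U.1 τ σ * f σ‖ ≤ ∑ _σ : CoinIdx d, ‖f‖ := norm_sum_le_of_le _ fun σ _ => by
        rw [norm_mul]
        exact (mul_le_of_le_one_left (norm_nonneg _) (entry_norm_bound_of_unitary U.2 τ σ)).trans
          (norm_le_pi_norm f σ)
    _ = 2 * d * ‖f‖ := by simp [mul_comm]

lemma norm_state_le (Cs : ℕ → Coin d) (n : ℕ) (x : Fin d → ℤ) :
    ‖state r φ₀ Cs n x‖ ≤ (2 * d) ^ n * ‖φ₀‖ := by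
  induction n generalizing x with
  | zero =>
    rcases eq_or_ne x 0 with rfl | hx
    · simp [state]
    · simpa [state, hx] using (pi_norm_const_le (0 : ℂ)).trans (by simp)
  | succ n ih =>
    refine (pi_norm_le_iff_of_nonneg (by positivity)).2 fun τ => ?_
    calc ‖((Cs n).1 *ᵥ state r φ₀ Cs n (x - r τ)) τ‖
        ≤ 2 * d * ‖state r φ₀ Cs n (x - r τ)‖ :=
          (norm_le_pi_norm _ τ).trans (norm_coin_mulVec_le _ _)
      _ ≤ 2 * d * ((2 * d) ^ n * ‖φ₀‖) := by gcongr; exact ih _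
      _ = (2 * d) ^ (n + 1) * ‖φ₀‖ := by ring

lemma state_congr (h : ∀ j < n, Cs j = Cs' j) : state r φ₀ Cs n = state r φ₀ Cs' n := by
  induction n with
  | zero => rfl
  | succ n ih =>
    rw [state, state, h n n.lt_succ_self, ih fun j hj => h j (hj.trans n.lt_succ_self)]

lemma measurable_state {X : Type*} [MeasurableSpace X] {Cs : X → ℕ → Coin d}
    (hCs : ∀ j, MeasurableCoin fun x => Cs x j) (n : ℕ) (k : Fin d → ℤ) (τ : CoinIdx d) :
    Measurable fun x => state r φ₀ (Cs x) n k τ := by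
  induction n generalizing k τ with
  | zero => exact measurable_const
  | succ n ih => exact Finset.measurable_fun_sum _ fun σ _ => (hCs n τ σ).mul (ih _ σ)

/-- The sites which can be reached in `n` steps. -/
def reach (r : CoinIdx d → Fin d → ℤ) : ℕ → Finset (Fin d → ℤ)
  | 0 => {0}
  | n + 1 => (reach r n).biUnion fun x => Finset.univ.image fun τ => x + r τ

lemma state_eq_zero_of_notMem_reach {x : Fin d → ℤ} (hx : x ∉ reach r n) :
    state r φ₀ Cs n x = 0 := by
  induction n generalizing x with
  | zero =>
    have hx0 : x ≠ 0 := by simpa [reach] using hx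
    ext τ
    simp [state, hx0]
  | succ n ih =>
    ext τ
    have hpred : x - r τ ∉ reach r n := fun h => hx <| Finset.mem_biUnion.2
      ⟨_, h, Finset.mem_image.2 ⟨τ, Finset.mem_univ τ, sub_add_cancel _ _⟩⟩
    simp [state, step, ih hpred]

/-- The displacement `k - n r̄` of a site from the mean position at time `n`. -/
def centredPos (r : CoinIdx d → Fin d → ℤ) (n : ℕ) (k : Fin d → ℤ) : Fin d → ℝ :=
  fun i => k i - n * meanJump r i

lemma centredPos_succ (n : ℕ) (x : Fin d → ℤ) (τ : CoinIdx d) :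
    centredPos r (n + 1) (x + r τ) = centredJump r τ + centredPos r n x := by
  ext i
  simp only [centredPos, centredJump, Pi.add_apply]
  push_cast
  ring

variable {y : Fin d → ℝ} {t : ℝ}

/-- The Fourier transform, at `v`, of the wave function `x ↦ e^{t y · (x - n r̄) / 2} ψ_n(x)`. The
tilt is split evenly between the wave function and its conjugate, so that the squared norm carries
the weight `e^{t y · (x - n r̄)}`. -/
def tiltedFourier (r : CoinIdx d → Fin d → ℤ) (φ₀ : CoinIdx d → ℂ) (y : Fin d → ℝ) (t : ℝ)
    (Cs : ℕ → Coin d) (n : ℕ) (v : Fin d → ℝ) (τ : CoinIdx d) : ℂ :=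
  ∑ x ∈ reach r n,
    torusChar x v * (Real.exp (t * (y ⬝ᵥ centredPos r n x) / 2) * state r φ₀ Cs n x τ)

lemma tiltedFourier_eq_tsum (v : Fin d → ℝ) (τ : CoinIdx d) :
    tiltedFourier r φ₀ y t Cs n v τ = ∑' x,
      torusChar x v * (Real.exp (t * (y ⬝ᵥ centredPos r n x) / 2) * state r φ₀ Cs n x τ) :=
  (tsum_eq_sum fun x hx => by simp [state_eq_zero_of_notMem_reach hx]).symm

/-- The factor which the tilt and the Fourier transform attach to a jump. -/
def jumpWeight (r : CoinIdx d → Fin d → ℤ) (y : Fin d → ℝ) (t : ℝ) (v : Fin d → ℝ)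
    (τ : CoinIdx d) : ℂ :=
  torusChar (r τ) v * Real.exp (t * (y ⬝ᵥ centredJump r τ) / 2)

lemma tiltedFourier_succ (v : Fin d → ℝ) (τ : CoinIdx d) :
    tiltedFourier r φ₀ y t Cs (n + 1) v τ =
      jumpWeight r y t v τ * ((Cs n).1 *ᵥ tiltedFourier r φ₀ y t Cs n v) τ := by
  have hexp : ∀ x, Real.exp (t * (y ⬝ᵥ centredPos r (n + 1) (x + r τ)) / 2) =
      Real.exp (t * (y ⬝ᵥ centredJump r τ) / 2) * Real.exp (t * (y ⬝ᵥ centredPos r n x) / 2) :=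
    fun x => by rw [← Real.exp_add, centredPos_succ, dotProduct_add, mul_add, add_div]
  have hstate : ∀ x, state r φ₀ Cs (n + 1) (x + r τ) τ =
      ∑ σ, (Cs n).1 τ σ * state r φ₀ Cs n x σ := fun x => by
    simp only [state, step, add_sub_cancel_right, mulVec, dotProduct]
  have hsummable : ∀ σ, Summable fun x => (Cs n).1 τ σ *
      (torusChar x v * (Real.exp (t * (y ⬝ᵥ centredPos r n x) / 2) * state r φ₀ Cs n x σ)) :=
    fun σ => summable_of_ne_finset_zero (s := reach r n) fun x hx => by
      simp [state_eq_zero_of_notMem_reach hx]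
  calc tiltedFourier r φ₀ y t Cs (n + 1) v τ
      = ∑' x, jumpWeight r y t v τ * ∑ σ, (Cs n).1 τ σ * (torusChar x v *
          (Real.exp (t * (y ⬝ᵥ centredPos r n x) / 2) * state r φ₀ Cs n x σ)) := by
        rw [tiltedFourier_eq_tsum, ← (Equiv.addRight (r τ)).tsum_eq]
        refine tsum_congr fun x => ?_
        simp only [Equiv.coe_addRight, hstate, hexp, Complex.ofReal_mul, torusChar_add,
          jumpWeight, Finset.mul_sum]
        exact Finset.sum_congr rfl fun σ _ => by ring
    _ = _ := by
        rw [tsum_mul_left, Summable.tsum_finsetSum fun σ _ => hsummable σ]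
        simp only [tsum_mul_left, mulVec, dotProduct, tiltedFourier_eq_tsum]

lemma jumpWeight_mul_star (v : Fin d → ℝ) (S : CoinIdx d × CoinIdx d) :
    jumpWeight r y t v S.1 * star (jumpWeight r y t v S.2) =
      Complex.exp (t * pairJump r y S) * Complex.exp (Complex.I *
        (((-v ⬝ᵥ fun i => (r S.1 i : ℝ)) + (v ⬝ᵥ fun i => (r S.2 i : ℝ)) : ℝ) : ℂ)) := by
  simp only [jumpWeight, torusChar, pairJump, Complex.ofReal_exp, ← Complex.exp_add]
  rw [Complex.star_def, ← Complex.exp_conj, ← Complex.exp_add]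
  congr 1
  simp only [map_add, map_neg, map_mul, Complex.conj_I, Complex.conj_ofReal, neg_dotProduct]
  push_cast
  ring

lemma integral_norm_sq_tiltedFourier (τ : CoinIdx d) :
    ∫ v, ‖tiltedFourier r φ₀ y t Cs n v τ‖ ^ 2 ∂torusMeasure d =
      ∑ k ∈ reach r n, ‖state r φ₀ Cs n k τ‖ ^ 2 * Real.exp (t * (y ⬝ᵥ centredPos r n k)) := by
  simp only [tiltedFourier, integral_norm_sq_sum_torusChar]
  refine Finset.sum_congr rfl fun k _ => ?_
  rw [norm_mul, Complex.norm_real, Real.norm_eq_abs, Real.abs_exp, mul_pow, ← Real.exp_nat_mul,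
    mul_comm, Nat.cast_ofNat, mul_div_cancel₀ _ two_ne_zero]

lemma exists_norm_tiltedFourier_le (r : CoinIdx d → Fin d → ℤ) (φ₀ : CoinIdx d → ℂ)
    (y : Fin d → ℝ) (t : ℝ) (n : ℕ) :
    ∃ K, ∀ Cs v τ, ‖tiltedFourier r φ₀ y t Cs n v τ‖ ≤ K := by
  refine ⟨∑ x ∈ reach r n, Real.exp (t * (y ⬝ᵥ centredPos r n x) / 2) * ((2 * d) ^ n * ‖φ₀‖),
    fun Cs v τ => norm_sum_le_of_le _ fun x _ => ?_⟩
  rw [norm_mul, norm_torusChar, one_mul, norm_mul, Complex.norm_real, Real.norm_eq_abs,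
    Real.abs_exp]
  gcongr
  exact (norm_le_pi_norm _ τ).trans (norm_state_le Cs n x)

section Measurability

variable {X : Type*} [MeasurableSpace X] {Cs : X → ℕ → Coin d} {v : X → Fin d → ℝ}

lemma measurable_tiltedFourier (hCs : ∀ j, MeasurableCoin fun x => Cs x j) (hv : Measurable v)
    (τ : CoinIdx d) : Measurable fun x => tiltedFourier r φ₀ y t (Cs x) n (v x) τ :=
  Finset.measurable_fun_sum _ fun k _ => ((continuous_torusChar k).measurable.comp hv).mul
    (measurable_const.mul (measurable_state hCs n k τ))

variable {ν : Measure X} [IsFiniteMeasure ν]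

lemma integrable_tiltedFourier_mul_star (hCs : ∀ j, MeasurableCoin fun x => Cs x j)
    (hv : Measurable v) (τ σ : CoinIdx d) :
    Integrable (fun x => tiltedFourier r φ₀ y t (Cs x) n (v x) τ *
      star (tiltedFourier r φ₀ y t (Cs x) n (v x) σ)) ν := by
  obtain ⟨K, hK⟩ := exists_norm_tiltedFourier_le r φ₀ y t n
  refine .of_bound ((measurable_tiltedFourier hCs hv τ).mul (continuous_star.measurable.comp
    (measurable_tiltedFourier hCs hv σ))).aestronglyMeasurable (K * K) (ae_of_all _ fun x => ?_)
  rw [norm_mul, norm_star]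
  exact mul_le_mul (hK _ _ _) (hK _ _ _) (norm_nonneg _)
    ((norm_nonneg _).trans (hK (Cs x) (v x) τ))

lemma integrable_norm_sq_tiltedFourier (hCs : ∀ j, MeasurableCoin fun x => Cs x j)
    (hv : Measurable v) (τ : CoinIdx d) :
    Integrable (fun x => ‖tiltedFourier r φ₀ y t (Cs x) n (v x) τ‖ ^ 2) ν := by
  have h := (integrable_tiltedFourier_mul_star (ν := ν) (r := r) (φ₀ := φ₀) (n := n) (y := y)
    (t := t) hCs hv τ τ).norm
  simpa only [norm_mul, norm_star, ← sq] using h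

end Measurability

end Walk

section Correlations

variable {d : ℕ} {Ω : Type*} [MeasurableSpace Ω] {μ : Measure Ω} [IsProbabilityMeasure μ]
  {C : Ω → Coin d} {r : CoinIdx d → Fin d → ℤ} {φ₀ : CoinIdx d → ℂ} {y : Fin d → ℝ} {t : ℝ}
  {n : ℕ} {v : Fin d → ℝ}

/-- The law of an i.i.d. sequence with common distribution `μ`. -/
abbrev pathMeasure (μ : Measure Ω) [IsProbabilityMeasure μ] : Measure (ℕ → Ω) :=
  Measure.infinitePi fun _ => μ

lemma measurableCoin_eval (hC : MeasurableCoin C) (j : ℕ) :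
    MeasurableCoin fun ω : ℕ → Ω => C (ω j) :=
  fun τ σ => (hC τ σ).comp (measurable_pi_apply j)

lemma integral_eval_mul_of_dependsOn {f : Ω → ℂ} {g : (ℕ → Ω) → ℂ} (hf : Measurable f)
    (hg : Measurable g) (hdep : DependsOn g (Set.Iio n)) :
    ∫ ω, f (ω n) * g ω ∂pathMeasure μ = (∫ a, f a ∂μ) * ∫ ω, g ω ∂pathMeasure μ := by
  obtain ⟨ω₀⟩ := nonempty_of_isProbabilityMeasure μ
  let extend : (Finset.range n → Ω) → ℕ → Ω := fun z j =>
    if h : j < n then z ⟨j, Finset.mem_range.2 h⟩ else ω₀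
  have hextend : Measurable extend := measurable_pi_lambda _ fun j => by
    by_cases h : j < n <;> simp only [extend, h, dif_pos, dif_neg, not_false_eq_true] <;> fun_prop
  have hgeq : ∀ ω : ℕ → Ω, g (extend fun i => ω i) = g ω := fun ω =>
    hdep fun j (hj : j < n) => by simp [extend, hj]
  have hindep := ((ProbabilityTheory.iIndepFun_infinitePi (P := fun _ : ℕ => μ)
    (X := fun _ ω => ω) fun _ => measurable_id).indepFun_finset {n} (Finset.range n) (by simp)
    fun i => measurable_pi_apply i).comp
    (hf.comp (measurable_pi_apply (⟨n, Finset.mem_singleton_self n⟩ : ({n} : Finset ℕ))))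
    (hg.comp hextend)
  have hmul := hindep.integral_fun_mul_eq_mul_integral
    ((hf.comp (measurable_pi_apply _)).comp
      (measurable_pi_lambda _ fun _ => measurable_pi_apply _)).aestronglyMeasurable
    ((hg.comp hextend).comp
      (measurable_pi_lambda _ fun _ => measurable_pi_apply _)).aestronglyMeasurable
  simp only [Function.comp_def, hgeq] at hmul
  have hmarginal : ∫ ω, f (ω n) ∂pathMeasure μ = ∫ a, f a ∂μ := by
    rw [← integral_map (φ := fun ω : ℕ → Ω => ω n) (measurable_pi_apply n).aemeasurable
      hf.aestronglyMeasurable, Measure.infinitePi_map_eval]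
  rw [hmul, hmarginal]

/-- The averaged correlations `𝔼 (ψ̂(τ) conj (ψ̂(τ')))` of the components of the Fourier transform
`ψ̂` of the tilted wave function. -/
def coinCorrelation (μ : Measure Ω) [IsProbabilityMeasure μ] (C : Ω → Coin d)
    (r : CoinIdx d → Fin d → ℤ) (φ₀ : CoinIdx d → ℂ) (y : Fin d → ℝ) (t : ℝ) (n : ℕ)
    (v : Fin d → ℝ) (S : CoinIdx d × CoinIdx d) : ℂ :=
  ∫ ω, tiltedFourier r φ₀ y t (fun j => C (ω j)) n v S.1 *
    star (tiltedFourier r φ₀ y t (fun j => C (ω j)) n v S.2) ∂pathMeasure μ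

lemma integral_coin_mul_tiltedFourier (hC : MeasurableCoin C) (S T : CoinIdx d × CoinIdx d) :
    ∫ ω, ((C (ω n)).1 S.1 T.1 * star ((C (ω n)).1 S.2 T.2)) *
        (tiltedFourier r φ₀ y t (fun j => C (ω j)) n v T.1 *
          star (tiltedFourier r φ₀ y t (fun j => C (ω j)) n v T.2)) ∂pathMeasure μ =
      meanTensor μ C S T * coinCorrelation μ C r φ₀ y t n v T := by
  have hmeas := fun τ => measurable_tiltedFourier (r := r) (φ₀ := φ₀) (y := y) (t := t) (n := n)
    (measurableCoin_eval hC) (measurable_const (a := v)) τ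
  refine integral_eval_mul_of_dependsOn (f := fun a => (C a).1 S.1 T.1 * star ((C a).1 S.2 T.2))
    ((hC _ _).mul (continuous_star.measurable.comp (hC _ _)))
    ((hmeas _).mul (continuous_star.measurable.comp (hmeas _))) fun ω ω' h => ?_
  have hstate : state r φ₀ (fun j => C (ω j)) n = state r φ₀ (fun j => C (ω' j)) n :=
    state_congr fun j hj => by rw [h j hj]
  simp only [tiltedFourier, hstate]

lemma integrable_coin_mul_tiltedFourier (hC : MeasurableCoin C) (S T : CoinIdx d × CoinIdx d) :
    Integrable (fun ω => ((C (ω n)).1 S.1 T.1 * star ((C (ω n)).1 S.2 T.2)) *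
        (tiltedFourier r φ₀ y t (fun j => C (ω j)) n v T.1 *
          star (tiltedFourier r φ₀ y t (fun j => C (ω j)) n v T.2))) (pathMeasure μ) := by
  have hcoin := measurableCoin_eval hC n
  refine (integrable_tiltedFourier_mul_star (measurableCoin_eval hC) measurable_const _ _).bdd_mul
    (c := 1) ((hcoin _ _).mul (continuous_star.measurable.comp (hcoin _ _))).aestronglyMeasurable
    (ae_of_all _ fun ω => ?_)
  rw [norm_mul, norm_star]
  exact mul_le_one₀ (entry_norm_bound_of_unitary (C (ω n)).2 _ _) (norm_nonneg _)
    (entry_norm_bound_of_unitary (C (ω n)).2 _ _)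

lemma coinCorrelation_succ (hC : MeasurableCoin C) :
    coinCorrelation μ C r φ₀ y t (n + 1) v =
      tiltedM μ C r y t v *ᵥ coinCorrelation μ C r φ₀ y t n v := by
  ext S
  have hstep : ∀ ω : ℕ → Ω, tiltedFourier r φ₀ y t (fun j => C (ω j)) (n + 1) v S.1 *
      star (tiltedFourier r φ₀ y t (fun j => C (ω j)) (n + 1) v S.2) =
      (jumpWeight r y t v S.1 * star (jumpWeight r y t v S.2)) *
        ∑ T : CoinIdx d × CoinIdx d, ((C (ω n)).1 S.1 T.1 * star ((C (ω n)).1 S.2 T.2)) *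
          (tiltedFourier r φ₀ y t (fun j => C (ω j)) n v T.1 *
            star (tiltedFourier r φ₀ y t (fun j => C (ω j)) n v T.2)) := fun ω => by
    simp only [tiltedFourier_succ, star_mul', mulVec, dotProduct, star_sum]
    rw [mul_mul_mul_comm, Finset.sum_mul_sum,
      Fintype.sum_prod_type (f := fun _ : CoinIdx d × CoinIdx d => _)]
    congr 1
    exact Finset.sum_congr rfl fun τ _ => Finset.sum_congr rfl fun σ _ => by ring
  simp only [coinCorrelation, hstep]
  rw [integral_const_mul,
    integral_finsetSum _ fun T _ => integrable_coin_mul_tiltedFourier hC S T]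
  simp only [integral_coin_mul_tiltedFourier hC]
  rw [jumpWeight_mul_star, tiltedM, avgM, phase, ← mulVec_mulVec, ← mulVec_mulVec,
    mulVec_diagonal, mulVec_diagonal, mul_assoc]
  rfl

/-- The averaged squared norm of the Fourier transform of the tilted wave function, that is, the
trace of `coinCorrelation`. -/
def tiltedNorm (μ : Measure Ω) [IsProbabilityMeasure μ] (C : Ω → Coin d)
    (r : CoinIdx d → Fin d → ℤ) (φ₀ : CoinIdx d → ℂ) (y : Fin d → ℝ) (t : ℝ) (n : ℕ)
    (v : Fin d → ℝ) : ℝ :=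
  ∫ ω, ∑ τ, ‖tiltedFourier r φ₀ y t (fun j => C (ω j)) n v τ‖ ^ 2 ∂pathMeasure μ

lemma tiltedNorm_zero : tiltedNorm μ C r φ₀ y t 0 v = ∑ τ, ‖φ₀ τ‖ ^ 2 := by
  simp [tiltedNorm, tiltedFourier, reach, state, torusChar, centredPos, dotProduct]

lemma sum_coinCorrelation_diag (hC : MeasurableCoin C) :
    ∑ τ, coinCorrelation μ C r φ₀ y t n v (τ, τ) = tiltedNorm μ C r φ₀ y t n v := by
  rw [tiltedNorm, integral_finsetSum _ fun τ _ =>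
    integrable_norm_sq_tiltedFourier (measurableCoin_eval hC) measurable_const τ,
    Complex.ofReal_sum]
  refine Finset.sum_congr rfl fun τ _ => ?_
  rw [← integral_complex_ofReal, coinCorrelation]
  congr! 2 with ω
  rw [Complex.star_def, Complex.mul_conj', Complex.ofReal_pow]

lemma norm_coinCorrelation_le (hC : MeasurableCoin C) (S : CoinIdx d × CoinIdx d) :
    ‖coinCorrelation μ C r φ₀ y t n v S‖ ≤ tiltedNorm μ C r φ₀ y t n v := by
  refine (norm_integral_le_integral_norm _).trans (integral_mono
    (integrable_tiltedFourier_mul_star (measurableCoin_eval hC) measurable_const _ _).norm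
    (integrable_finsetSum _ fun τ _ =>
      integrable_norm_sq_tiltedFourier (measurableCoin_eval hC) measurable_const τ) fun ω => ?_)
  have hle := fun τ => Finset.single_le_sum
    (f := fun τ => ‖tiltedFourier r φ₀ y t (fun j => C (ω j)) n v τ‖ ^ 2)
    (fun _ _ => sq_nonneg _) (Finset.mem_univ τ)
  simp only [norm_mul, norm_star]
  linarith [two_mul_le_add_sq ‖tiltedFourier r φ₀ y t (fun j => C (ω j)) n v S.1‖
    ‖tiltedFourier r φ₀ y t (fun j => C (ω j)) n v S.2‖, hle S.1, hle S.2]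

lemma integrable_sum_norm_sq_tiltedFourier (hC : MeasurableCoin C) :
    Integrable (fun p : (ℕ → Ω) × (Fin d → ℝ) =>
      ∑ τ, ‖tiltedFourier r φ₀ y t (fun j => C (p.1 j)) n p.2 τ‖ ^ 2)
      ((pathMeasure μ).prod (torusMeasure d)) :=
  integrable_finsetSum _ fun τ _ => integrable_norm_sq_tiltedFourier
    (fun j τ σ => (measurableCoin_eval hC j τ σ).comp measurable_fst) measurable_snd τ

lemma integrable_tiltedNorm (hC : MeasurableCoin C) :
    Integrable (tiltedNorm μ C r φ₀ y t n) (torusMeasure d) :=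
  (integrable_sum_norm_sq_tiltedFourier hC).integral_prod_right

lemma integrable_siteProb (hC : MeasurableCoin C) (k : Fin d → ℤ) :
    Integrable (fun ω : ℕ → Ω => siteProb r φ₀ (fun j => C (ω j)) n k) (pathMeasure μ) := by
  refine integrable_finsetSum _ fun τ _ => .of_bound ((measurable_state (measurableCoin_eval hC)
    n k τ).norm.pow_const 2).aestronglyMeasurable (((2 * d) ^ n * ‖φ₀‖) ^ 2)
    (ae_of_all _ fun ω => ?_)
  rw [norm_pow, norm_norm]
  gcongr
  exact (norm_le_pi_norm _ τ).trans (norm_state_le _ n k)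

lemma avgProb_eq_zero_of_notMem_reach {k : Fin d → ℤ} (hk : k ∉ reach r n) :
    avgProb μ C r φ₀ n k = 0 := by
  simp [avgProb, siteProb, state_eq_zero_of_notMem_reach hk]

lemma sum_avgProb_mul_exp (hC : MeasurableCoin C) :
    ∑ k ∈ reach r n, avgProb μ C r φ₀ n k * Real.exp (t * (y ⬝ᵥ centredPos r n k)) =
      ∫ v, tiltedNorm μ C r φ₀ y t n v ∂torusMeasure d := by
  have hplancherel : ∀ Cs, ∫ v, ∑ τ, ‖tiltedFourier r φ₀ y t Cs n v τ‖ ^ 2 ∂torusMeasure d =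
      ∑ k ∈ reach r n, siteProb r φ₀ Cs n k * Real.exp (t * (y ⬝ᵥ centredPos r n k)) :=
    fun Cs => by
      rw [integral_finsetSum _ fun τ _ => integrable_norm_sq_tiltedFourier (Cs := fun _ => Cs)
        (v := fun v => v) (fun _ _ _ => measurable_const) measurable_id τ]
      simp only [integral_norm_sq_tiltedFourier, siteProb, Finset.sum_mul]
      exact Finset.sum_comm
  simp only [tiltedNorm]
  rw [integral_integral_swap
    (f := fun v (ω : ℕ → Ω) => ∑ τ, ‖tiltedFourier r φ₀ y t (fun j => C (ω j)) n v τ‖ ^ 2)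
    (integrable_sum_norm_sq_tiltedFourier hC).swap]
  simp only [hplancherel]
  rw [integral_finsetSum _ fun k _ => (integrable_siteProb hC k).mul_const _]
  simp only [integral_mul_const, avgProb]

end Correlations

/-! ### Growth of the tilted walk -/

section Growth

variable {d : ℕ} {Ω : Type*} [MeasurableSpace Ω] {μ : Measure Ω} [IsProbabilityMeasure μ]
  {C : Ω → Coin d} {r : CoinIdx d → Fin d → ℤ} {φ₀ : CoinIdx d → ℂ} {y : Fin d → ℝ} {t : ℝ}
  {n : ℕ} {v : Fin d → ℝ}

lemma tiltedNorm_nonneg : 0 ≤ tiltedNorm μ C r φ₀ y t n v :=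
  integral_nonneg fun _ => Finset.sum_nonneg fun _ _ => sq_nonneg _

lemma norm_dotProduct_coinCorrelation_le (hC : MeasurableCoin C)
    {e : CoinIdx d × CoinIdx d → ℂ} {ε : ℝ} (he : ∑ T, ‖e T‖ ≤ ε) :
    ‖e ⬝ᵥ coinCorrelation μ C r φ₀ y t n v‖ ≤ ε * tiltedNorm μ C r φ₀ y t n v :=
  calc ‖e ⬝ᵥ coinCorrelation μ C r φ₀ y t n v‖
      ≤ ∑ T, ‖e T‖ * tiltedNorm μ C r φ₀ y t n v := norm_sum_le_of_le _ fun T _ => by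
        rw [norm_mul]
        exact mul_le_mul_of_nonneg_left (norm_coinCorrelation_le hC T) (norm_nonneg _)
    _ ≤ ε * tiltedNorm μ C r φ₀ y t n v := by
        rw [← Finset.sum_mul]
        exact mul_le_mul_of_nonneg_right he tiltedNorm_nonneg

lemma abs_re_dotProduct_coinCorrelation_sub_le (hC : MeasurableCoin C)
    {η : CoinIdx d × CoinIdx d → ℂ} {ε : ℝ} (hη : ∑ T, ‖η T - diagVec d T‖ ≤ ε) :
    |(η ⬝ᵥ coinCorrelation μ C r φ₀ y t n v).re - tiltedNorm μ C r φ₀ y t n v| ≤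
      ε * tiltedNorm μ C r φ₀ y t n v := by
  have htrace : (diagVec d ⬝ᵥ coinCorrelation μ C r φ₀ y t n v).re =
      tiltedNorm μ C r φ₀ y t n v := by
    rw [diagVec_dotProduct, sum_coinCorrelation_diag hC, Complex.ofReal_re]
  rw [← htrace, ← Complex.sub_re, ← sub_dotProduct, htrace]
  exact (Complex.abs_re_le_norm _).trans (norm_dotProduct_coinCorrelation_le hC hη)

lemma abs_re_dotProduct_coinCorrelation_succ_sub_le (hC : MeasurableCoin C)
    {η : CoinIdx d × CoinIdx d → ℂ} {lam κ : ℝ}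
    (hη : ∑ T, ‖(η ᵥ* tiltedM μ C r y t v) T - lam * η T‖ ≤ κ) :
    |(η ⬝ᵥ coinCorrelation μ C r φ₀ y t (n + 1) v).re -
        lam * (η ⬝ᵥ coinCorrelation μ C r φ₀ y t n v).re| ≤
      κ * tiltedNorm μ C r φ₀ y t n v := by
  rw [coinCorrelation_succ hC, dotProduct_mulVec, ← Complex.re_ofReal_mul, ← smul_eq_mul,
    ← smul_dotProduct, ← Complex.sub_re, ← sub_dotProduct]
  exact (Complex.abs_re_le_norm _).trans (norm_dotProduct_coinCorrelation_le hC hη)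

/-- Pairing with an approximate left eigenvector turns the linear evolution of the correlations
into a scalar recursion with almost constant ratio. -/
lemma tiltedNorm_bounds_of_approxEigenvector (hC : MeasurableCoin C)
    {η : CoinIdx d × CoinIdx d → ℂ} {lam κ : ℝ} (hlam : 2 * κ ≤ lam)
    (hclose : ∑ T, ‖η T - diagVec d T‖ ≤ 1 / 2)
    (hres : ∑ T, ‖(η ᵥ* tiltedM μ C r y t v) T - lam * η T‖ ≤ κ) :
    1 / 3 * ((lam - 2 * κ) ^ n * ∑ τ, ‖φ₀ τ‖ ^ 2) ≤ tiltedNorm μ C r φ₀ y t n v ∧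
      tiltedNorm μ C r φ₀ y t n v ≤ 3 * ((lam + 2 * κ) ^ n * ∑ τ, ‖φ₀ τ‖ ^ 2) := by
  have hκ : 0 ≤ κ := (Finset.sum_nonneg fun _ _ => norm_nonneg _).trans hres
  set h := fun m => tiltedNorm μ C r φ₀ y t m v
  set W := fun m => (η ⬝ᵥ coinCorrelation μ C r φ₀ y t m v).re
  have hWh : ∀ m, h m ≤ 2 * W m ∧ W m ≤ 3 / 2 * h m := fun m => by
    have hdiff : |W m - h m| ≤ 1 / 2 * h m := abs_re_dotProduct_coinCorrelation_sub_le hC hclose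
    constructor <;> linarith [abs_le.1 hdiff]
  have hratio : ∀ m, (lam - 2 * κ) * W m ≤ W (m + 1) ∧ W (m + 1) ≤ (lam + 2 * κ) * W m :=
    fun m => by
      have hstep : |W (m + 1) - lam * W m| ≤ κ * h m :=
        abs_re_dotProduct_coinCorrelation_succ_sub_le hC hres
      have hκh : κ * h m ≤ κ * (2 * W m) := mul_le_mul_of_nonneg_left (hWh m).1 hκ
      constructor <;> linarith [abs_le.1 hstep]
  have hlow := geom_le (sub_nonneg.2 hlam) n fun k _ => (hratio k).1
  have hup := le_geom (u := W) (by linarith) n fun k _ => (hratio k).2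
  rw [← tiltedNorm_zero (μ := μ) (C := C) (r := r) (y := y) (t := t) (v := v)]
  have hlow₀ := mul_le_mul_of_nonneg_left (hWh 0).1 (pow_nonneg (sub_nonneg.2 hlam) n)
  have hup₀ := mul_le_mul_of_nonneg_left (hWh 0).2
    (pow_nonneg (by linarith : 0 ≤ lam + 2 * κ) n)
  constructor <;> linarith [(hWh n).1, (hWh n).2]

lemma eventually_approxLeftEigenvector (hC : MeasurableCoin C) (hS : SimpleEigenvalueOne μ C r)
    (y : Fin d → ℝ) {κ : ℝ} (hκ : 0 < κ) :
    ∀ᶠ t : ℝ in 𝓝 0, ∀ v ∈ torusBox d,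
      ∑ T, ‖approxLeftEigenvector μ C r y t v T - diagVec d T‖ ≤ 1 / 2 ∧
      ∑ T, ‖(approxLeftEigenvector μ C r y t v ᵥ* tiltedM μ C r y t v) T -
        (1 + t ^ 2 * (quad μ C r y v / 2) : ℝ) * approxLeftEigenvector μ C r y t v T‖ ≤
          κ * t ^ 2 := by
  have ht : Tendsto (fun t : ℝ => (t : ℂ)) (𝓝 0) (𝓝 0) :=
    Complex.continuous_ofReal.tendsto' 0 0 Complex.ofReal_zero
  have hclose := Asymptotics.IsLittleO.sum (s := Finset.univ) fun T _ =>
    ((isBigO_approxLeftEigenvector hC hS y T).1.trans_isLittleO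
      (((Asymptotics.isLittleO_one_iff ℝ).2 ht).comp_tendsto tendsto_fst)).norm_left
  have hres := Asymptotics.IsLittleO.sum (s := Finset.univ) fun T _ =>
    ((isBigO_approxLeftEigenvector hC hS y T).2.trans_isLittleO
      (((Asymptotics.isLittleO_pow_pow (by norm_num : 2 < 3)).comp_tendsto ht).comp_tendsto
        tendsto_fst)).norm_left
  filter_upwards [eventually_prod_principal_iff.1 (hclose.def one_half_pos),
    eventually_prod_principal_iff.1 (hres.def hκ)] with t ht₁ ht₂ v hv
  exact ⟨(le_abs_self _).trans (by simpa using ht₁ v hv),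
    (le_abs_self _).trans (by simpa using ht₂ v hv)⟩

lemma eventually_exp_le_one_add (K : ℝ) {δ : ℝ} (hδ : 0 < δ) :
    ∀ᶠ t : ℝ in 𝓝 0, ∀ l, |l| ≤ K → Real.exp (t ^ 2 * (l - δ)) ≤ 1 + t ^ 2 * (l - δ / 2) := by
  have hsq : Tendsto (fun t : ℝ => t ^ 2) (𝓝 0) (𝓝 0) := (continuous_pow 2).tendsto' 0 0 (by simp)
  have hlin : Tendsto (fun t : ℝ => t ^ 2 * (K + δ)) (𝓝 0) (𝓝 0) := by
    simpa using hsq.mul_const (K + δ)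
  have hquad : Tendsto (fun t : ℝ => t ^ 2 * (K + δ) ^ 2) (𝓝 0) (𝓝 0) := by
    simpa using hsq.mul_const ((K + δ) ^ 2)
  filter_upwards [hlin.eventually_le_const one_pos, hquad.eventually_le_const (half_pos hδ)]
    with t ht₁ ht₂ l hl
  have habs : |l - δ| ≤ K + δ := (abs_sub _ _).trans (by rw [abs_of_pos hδ]; gcongr)
  have hle : |t ^ 2 * (l - δ)| ≤ 1 := by
    rw [abs_mul, abs_of_nonneg (sq_nonneg t)]
    exact (mul_le_mul_of_nonneg_left habs (sq_nonneg t)).trans ht₁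
  have hsq_le : (t ^ 2 * (l - δ)) ^ 2 ≤ t ^ 2 * (δ / 2) :=
    calc (t ^ 2 * (l - δ)) ^ 2 = t ^ 2 * (t ^ 2 * |l - δ| ^ 2) := by rw [sq_abs]; ring
      _ ≤ t ^ 2 * (t ^ 2 * (K + δ) ^ 2) := by gcongr
      _ ≤ t ^ 2 * (δ / 2) := by gcongr
  linarith [(abs_le.1 (Real.abs_exp_sub_one_sub_id_le hle)).2]

/-- No spectral gap is needed here: the correlations are dominated by their trace, so that the
approximate left eigenvector alone controls the growth. -/
lemma eventually_tiltedNorm_bounds (hC : MeasurableCoin C) (hS : SimpleEigenvalueOne μ C r)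
    (hφ₀ : ∑ τ, ‖φ₀ τ‖ ^ 2 = 1) (y : Fin d → ℝ) {δ : ℝ} (hδ : 0 < δ) :
    ∀ᶠ t : ℝ in 𝓝 0, ∀ v ∈ torusBox d, ∀ n : ℕ,
      1 / 3 * Real.exp (n * t ^ 2 * (quad μ C r y v / 2 - δ)) ≤ tiltedNorm μ C r φ₀ y t n v ∧
      tiltedNorm μ C r φ₀ y t n v ≤ 3 * Real.exp (n * t ^ 2 * (quad μ C r y v / 2 + δ)) := by
  obtain ⟨K, hK⟩ := (isCompact_Icc (a := 0) (b := fun _ : Fin d => 2 * Real.pi))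
    |>.exists_bound_of_continuousOn ((continuous_quad hC hS y).div_const 2).continuousOn
  filter_upwards [eventually_approxLeftEigenvector hC hS y (κ := δ / 4) (by positivity),
    eventually_exp_le_one_add K hδ] with t happrox hexp v hv n
  obtain ⟨hclose, hres⟩ := happrox v hv
  have hlow := hexp _ (hK v hv)
  have ht : 0 ≤ t ^ 2 * δ := mul_nonneg (sq_nonneg t) hδ.le
  have hpos := (Real.exp_pos _).trans_le hlow
  have hup : 1 + t ^ 2 * (quad μ C r y v / 2 + δ / 2) ≤
      Real.exp (t ^ 2 * (quad μ C r y v / 2 + δ)) := by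
    refine le_trans ?_ (Real.add_one_le_exp _)
    linarith
  obtain ⟨hge, hle⟩ := tiltedNorm_bounds_of_approxEigenvector (φ₀ := φ₀) hC
    (by linarith) hclose hres (n := n)
  rw [hφ₀, mul_one] at hge hle
  simp only [mul_assoc, Real.exp_nat_mul]
  refine ⟨le_trans ?_ hge, hle.trans ?_⟩ <;> gcongr <;> linarith

end Growth

/-! ### Laplace's principle -/

section Laplace

variable {ι : Type*} {l : Filter ι} {a : ι → ℝ}

lemma tendsto_log_of_exp_bounds (ha : Tendsto a l atTop) {I : ι → ℝ} {L : ℝ}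
    (hlow : ∀ δ > 0, ∃ b > 0, ∀ᶠ n in l, b * Real.exp (a n * (L - δ)) ≤ I n)
    (hup : ∀ δ > 0, ∃ b > 0, ∀ᶠ n in l, I n ≤ b * Real.exp (a n * (L + δ))) :
    Tendsto (fun n => 1 / a n * Real.log (I n)) l (𝓝 L) := by
  have hinv : ∀ b : ℝ, Tendsto (fun n => 1 / a n * Real.log b) l (𝓝 0) := fun b => by
    simpa using (tendsto_inv_atTop_zero.comp ha).mul_const (Real.log b)
  have hlog : ∀ b x n, 0 < b → 0 < a n →
      1 / a n * Real.log (b * Real.exp (a n * x)) = 1 / a n * Real.log b + x :=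
    fun b x n hb hn => by
      rw [Real.log_mul hb.ne' (Real.exp_ne_zero _), Real.log_exp]
      field_simp
  refine tendsto_order.2 ⟨fun c hc => ?_, fun c hc => ?_⟩
  · obtain ⟨b, hb, hI⟩ := hlow ((L - c) / 2) (by linarith)
    filter_upwards [hI, ha.eventually_gt_atTop 0,
      (hinv b).eventually_const_lt (show (c - L) / 2 < 0 by linarith)] with n hn hapos hsmall
    have hle : 1 / a n * Real.log b + (L - (L - c) / 2) ≤ 1 / a n * Real.log (I n) := by
      rw [← hlog b _ n hb hapos]
      gcongr
    linarith
  · obtain ⟨b, hb, hI⟩ := hup ((c - L) / 2) (by linarith)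
    obtain ⟨b', hb', hI'⟩ := hlow 1 one_pos
    filter_upwards [hI, hI', ha.eventually_gt_atTop 0,
      (hinv b).eventually_lt_const (show 0 < (c - L) / 2 by linarith)] with n hn hn' hapos hsmall
    have hIpos : 0 < I n := lt_of_lt_of_le (by positivity) hn'
    have hle : 1 / a n * Real.log (I n) ≤ 1 / a n * Real.log b + (L + (c - L) / 2) := by
      rw [← hlog b _ n hb hapos]
      gcongr
    linarith

variable {X : Type*} [MeasurableSpace X] {ν : Measure X} [IsFiniteMeasure ν]
  {f : X → ℝ} {x₀ : X} {c : ℝ} {H : ι → X → ℝ}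

lemma eventually_integral_le_mul_exp (ha : Tendsto a l atTop) (hmax : ∀ x, f x ≤ f x₀)
    (hc : 0 < c) (hint : ∀ n, Integrable (H n) ν)
    (hup : ∀ δ > 0, ∀ᶠ n in l, ∀ᵐ x ∂ν, H n x ≤ c * Real.exp (a n * (f x + δ)))
    {δ : ℝ} (hδ : 0 < δ) :
    ∀ᶠ n in l, ∫ x, H n x ∂ν ≤ ν.real Set.univ * c * Real.exp (a n * (f x₀ + δ)) := by
  filter_upwards [hup δ hδ, ha.eventually_ge_atTop 0] with n hn hapos
  calc ∫ x, H n x ∂ν ≤ ∫ _, c * Real.exp (a n * (f x₀ + δ)) ∂ν := by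
        refine integral_mono_ae (hint n) (integrable_const _) (hn.mono fun x hx => ?_)
        calc H n x ≤ c * Real.exp (a n * (f x + δ)) := hx
          _ ≤ c * Real.exp (a n * (f x₀ + δ)) := by
            gcongr
            exact hmax x
    _ = ν.real Set.univ * c * Real.exp (a n * (f x₀ + δ)) := by
        rw [integral_const, smul_eq_mul, mul_assoc]

variable [TopologicalSpace X] [OpensMeasurableSpace X]

lemma exists_mul_exp_le_integral (ha : Tendsto a l atTop)
    (hf : ContinuousAt f x₀) (hx₀ : x₀ ∈ ν.support) (hc : 0 < c) (hint : ∀ n, Integrable (H n) ν)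
    (hlow : ∀ δ > 0, ∀ᶠ n in l, ∀ᵐ x ∂ν, c * Real.exp (a n * (f x - δ)) ≤ H n x)
    {δ : ℝ} (hδ : 0 < δ) :
    ∃ b > 0, ∀ᶠ n in l, b * Real.exp (a n * (f x₀ - δ)) ≤ ∫ x, H n x ∂ν := by
  obtain ⟨s, hs, hsopen, hx₀s⟩ := mem_nhds_iff.1
    (hf.eventually_const_lt (show f x₀ - δ / 2 < f x₀ by linarith))
  have hspos : 0 < ν.real s := ENNReal.toReal_pos
    ((Measure.mem_support_iff_forall _).1 hx₀ s (hsopen.mem_nhds hx₀s)).ne' (measure_ne_top _ _)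
  refine ⟨ν.real s * c, by positivity, ?_⟩
  filter_upwards [hlow (δ / 2) (half_pos hδ), ha.eventually_ge_atTop 0] with n hn hapos
  have hnonneg : 0 ≤ᵐ[ν] H n := hn.mono fun x hx => le_trans (by positivity) hx
  calc ν.real s * c * Real.exp (a n * (f x₀ - δ))
      = ∫ _ in s, c * Real.exp (a n * (f x₀ - δ)) ∂ν := by
        rw [setIntegral_const, smul_eq_mul, mul_assoc]
    _ ≤ ∫ x in s, H n x ∂ν := by
        refine setIntegral_mono_on_ae (integrable_const _).integrableOn (hint n).integrableOn
          hsopen.measurableSet (hn.mono fun x hx hxs => le_trans ?_ hx)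
        have hfx : f x₀ - δ / 2 < f x := hs hxs
        gcongr c * Real.exp (a n * ?_)
        linarith
    _ ≤ ∫ x, H n x ∂ν := setIntegral_le_integral (hint n) hnonneg

theorem tendsto_log_integral (ha : Tendsto a l atTop)
    (hf : ContinuousAt f x₀) (hmax : ∀ x, f x ≤ f x₀) (hx₀ : x₀ ∈ ν.support) {c c' : ℝ}
    (hc : 0 < c) (hc' : 0 < c') (hint : ∀ n, Integrable (H n) ν)
    (hlow : ∀ δ > 0, ∀ᶠ n in l, ∀ᵐ x ∂ν, c * Real.exp (a n * (f x - δ)) ≤ H n x)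
    (hup : ∀ δ > 0, ∀ᶠ n in l, ∀ᵐ x ∂ν, H n x ≤ c' * Real.exp (a n * (f x + δ))) :
    Tendsto (fun n => 1 / a n * Real.log (∫ x, H n x ∂ν)) l (𝓝 (f x₀)) := by
  have hν : 0 < ν.real Set.univ := ENNReal.toReal_pos
    ((Measure.mem_support_iff_forall _).1 hx₀ _ univ_mem).ne' (measure_ne_top _ _)
  exact tendsto_log_of_exp_bounds ha
    (fun δ hδ => exists_mul_exp_le_integral ha hf hx₀ hc hint hlow hδ)
    fun δ hδ => ⟨_, by positivity, eventually_integral_le_mul_exp ha hmax hc' hint hup hδ⟩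

end Laplace

section Limit

variable {d : ℕ} {Ω : Type*} [MeasurableSpace Ω] {μ : Measure Ω} [IsProbabilityMeasure μ]
  {C : Ω → Coin d} {r : CoinIdx d → Fin d → ℤ} {φ₀ : CoinIdx d → ℂ} {a : ℕ → ℝ}

lemma ae_mem_torusBox : ∀ᵐ v ∂torusMeasure d, v ∈ torusBox d := by
  have hcoord : ∀ i, ∀ᵐ v ∂torusMeasure d, v i ∈ Set.Ioc 0 (2 * Real.pi) := fun i =>
    (Measure.quasiMeasurePreserving_eval _ i).ae
      (ProbabilityTheory.ae_cond_mem measurableSet_Ioc)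
  filter_upwards [ae_all_iff.2 hcoord] with v hv
  exact ⟨fun i => (hv i).1.le, fun i => (hv i).2⟩

lemma mem_support_torusMeasure {v : Fin d → ℝ} (hv : ∀ i, v i ∈ Set.Ico 0 (2 * Real.pi)) :
    v ∈ (torusMeasure d).support := by
  refine (Measure.mem_support_iff_forall _).2 fun s hs => ?_
  obtain ⟨ε, hε, hball⟩ := Metric.mem_nhds_iff.1 hs
  set u := fun i => Set.Ioo (v i) (min (v i + ε) (2 * Real.pi))
  have hsub : Set.univ.pi u ⊆ s := fun w hw => hball <| (dist_pi_lt_iff hε).2 fun i => by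
    have hlt := (hw i trivial).2.trans_le (min_le_left _ _)
    rw [Real.dist_eq, abs_lt]
    constructor <;> linarith [(hw i trivial).1]
  refine lt_of_lt_of_le (pos_iff_ne_zero.2 ?_) (measure_mono hsub)
  rw [torusMeasure, Measure.pi_pi, Finset.prod_ne_zero_iff]
  intro i _
  have hinter : Set.Ioc 0 (2 * Real.pi) ∩ u i = u i := Set.inter_eq_right.2 fun x hx =>
    ⟨(hv i).1.trans_lt hx.1, (hx.2.trans_le (min_le_right _ _)).le⟩
  rw [ProbabilityTheory.cond_apply measurableSet_Ioc, hinter]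
  simp [u, hε, (hv i).2, ENNReal.mul_eq_top]

lemma logGen_smul_eq_log_integral (hC : MeasurableCoin C) {n : ℕ} (ha : 0 < a n)
    (y : Fin d → ℝ) :
    logGen μ C r φ₀ a n (a n • y) =
      Real.log (∫ v, tiltedNorm μ C r φ₀ y (√(a n / n)) n v ∂torusMeasure d) := by
  have hcoef : a n / √(n * a n) = √(a n / n) := by
    rw [mul_comm, Real.sqrt_mul ha.le, Real.sqrt_div ha.le, ← div_div, Real.div_sqrt]
  have hexponent : ∀ k, a n • y ⬝ᵥ rescaledPos r a n k =
      √(a n / n) * (y ⬝ᵥ centredPos r n k) := fun k => by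
    rw [← hcoef]
    simp only [dotProduct, rescaledPos, centredPos, Pi.smul_apply, smul_eq_mul, Finset.mul_sum]
    exact Finset.sum_congr rfl fun i _ => by ring
  rw [← sum_avgProb_mul_exp hC, logGen]
  simp only [hexponent]
  rw [tsum_eq_sum fun k hk => by rw [avgProb_eq_zero_of_notMem_reach hk, zero_mul]]

theorem tendsto_logGen (hC : MeasurableCoin C) (hS : SimpleEigenvalueOne μ C r)
    (hφ₀ : ∑ τ, ‖φ₀ τ‖ ^ 2 = 1) (ha_top : Tendsto a atTop atTop)
    (ha_zero : Tendsto (fun n : ℕ => a n / n) atTop (𝓝 0)) {y v₁ : Fin d → ℝ}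
    (hv₁ : v₁ ∈ maxPoints (quad μ C r y)) :
    Tendsto (fun n : ℕ => 1 / a n * logGen μ C r φ₀ a n (a n • y)) atTop
      (𝓝 (1 / 2 * quad μ C r y v₁)) := by
  have ht : Tendsto (fun n : ℕ => √(a n / n)) atTop (𝓝 0) :=
    (Real.continuous_sqrt.tendsto' 0 0 Real.sqrt_zero).comp ha_zero
  have hpos : ∀ᶠ n : ℕ in atTop, n ≠ 0 ∧ 0 < a n :=
    (eventually_ne_atTop 0).and (ha_top.eventually_gt_atTop 0)
  have hscale : ∀ n : ℕ, n ≠ 0 → 0 < a n → n * √(a n / n) ^ 2 = a n := fun n hn han => by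
    rw [Real.sq_sqrt (by positivity)]
    field_simp
  have hbounds : ∀ δ > 0, ∀ᶠ n : ℕ in atTop, ∀ᵐ v ∂torusMeasure d,
      1 / 3 * Real.exp (a n * (quad μ C r y v / 2 - δ)) ≤
          tiltedNorm μ C r φ₀ y (√(a n / n)) n v ∧
        tiltedNorm μ C r φ₀ y (√(a n / n)) n v ≤
          3 * Real.exp (a n * (quad μ C r y v / 2 + δ)) := fun δ hδ => by
    filter_upwards [hpos, ht.eventually (eventually_tiltedNorm_bounds hC hS hφ₀ y hδ)]
      with n hn hbound
    filter_upwards [ae_mem_torusBox] with v hv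
    simpa only [hscale n hn.1 hn.2] using hbound v hv n
  have hlim := tendsto_log_integral (f := fun v => quad μ C r y v / 2) ha_top
    ((continuous_quad hC hS y).div_const 2).continuousAt
    (fun w => div_le_div_of_nonneg_right (hv₁.2 w) two_pos.le) (mem_support_torusMeasure hv₁.1)
    (by norm_num) three_pos (fun n => integrable_tiltedNorm hC)
    (fun δ hδ => (hbounds δ hδ).mono fun n hn => hn.mono fun v hv => hv.1)
    fun δ hδ => (hbounds δ hδ).mono fun n hn => hn.mono fun v hv => hv.2
  rw [one_div_mul_eq_div]
  exact hlim.congr' (hpos.mono fun n hn => by simp only [logGen_smul_eq_log_integral hC hn.2])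

end Limit

/-! ### Smooth dependence of the maximum on a parameter -/

section CriticalBranch

variable {E F : Type*} [NormedAddCommGroup E] [NormedSpace ℝ E] [CompleteSpace E]
  [NormedAddCommGroup F] [NormedSpace ℝ F] [CompleteSpace F]

theorem exists_critical_branch {n : WithTop ℕ∞} (hn : n ≠ 0) {q : E × F → ℝ}
    (hq : ContDiff ℝ (n + 1) q) {y₀ : E} {v₀ : F}
    (hcrit : fderiv ℝ (fun v => q (y₀, v)) v₀ = 0)
    (hnondeg : (fderiv ℝ (fderiv ℝ fun v => q (y₀, v)) v₀).IsInvertible) :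
    ∃ w : E → F, ContDiffAt ℝ n w y₀ ∧
      ∀ᶠ p : E × F in 𝓝 (y₀, v₀), fderiv ℝ (fun v => q (p.1, v)) p.2 = 0 → p.2 = w p.1 := by
  set D : E × F → F →L[ℝ] ℝ := fun p => fderiv ℝ (fun v => q (p.1, v)) p.2
  have hD : ContDiffAt ℝ n D (y₀, v₀) := by
    refine (ContDiff.fderiv_succ (f := fun (p : E × F) v => q (p.1, v)) ?_
      contDiff_snd).contDiffAt
    exact hq.comp (by fun_prop)
  have hpartial : fderiv ℝ (fderiv ℝ fun v => q (y₀, v)) v₀ =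
      fderiv ℝ D (y₀, v₀) ∘L .inr ℝ E F :=
    ((hD.differentiableAt hn).hasFDerivAt.comp v₀ (hasFDerivAt_prodMk_right y₀ v₀)).fderiv
  rw [hpartial] at hnondeg
  refine ⟨hD.implicitFunction hn hnondeg, hD.contDiffAt_implicitFunction hn hnondeg, ?_⟩
  filter_upwards [hD.eventually_apply_eq_iff_implicitFunction hn hnondeg] with p hp hDp
  exact (hp.1 (hDp.trans hcrit.symm)).symm

end CriticalBranch

section MaxPoints

variable {d : ℕ}

lemma isInvertible_fderiv_fderiv_of_det_hessian_ne_zero {g : (Fin d → ℝ) → ℝ} {v : Fin d → ℝ}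
    (hdet : (hessian g v).det ≠ 0) : (fderiv ℝ (fderiv ℝ g) v).IsInvertible := by
  have hvecMul : ∀ k j, (k ᵥ* hessian g v) j = fderiv ℝ (fderiv ℝ g) v k (Pi.single j 1) :=
    fun k j => by
      conv_rhs => rw [pi_eq_sum_univ' k]
      simp [vecMul, dotProduct, hessian, iteratedFDeriv_two_apply]
  have hinj : Function.Injective (fderiv ℝ (fderiv ℝ g) v) :=
    (injective_iff_map_eq_zero _).2 fun k hk => eq_zero_of_vecMul_eq_zero hdet <| by
      ext j
      simp [hvecMul, hk]
  have hrank : Module.finrank ℝ (Fin d → ℝ) = Module.finrank ℝ ((Fin d → ℝ) →L[ℝ] ℝ) := by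
    rw [← LinearMap.toContinuousLinearMap.finrank_eq, Subspace.dual_finrank_eq]
  exact ⟨(LinearEquiv.ofInjectiveOfFinrankEq
    (fderiv ℝ (fderiv ℝ g) v : (Fin d → ℝ) →ₗ[ℝ] _) hinj hrank).toContinuousLinearEquiv, rfl⟩

lemma TorusPeriodic.exists_add_period_mem_maxPoints {g : (Fin d → ℝ) → ℝ}
    (hg : TorusPeriodic g) {x : Fin d → ℝ} (hx : ∀ w, g w ≤ g x) :
    ∃ k : Fin d → ℤ, (x + fun i => k i • (2 * Real.pi)) ∈ maxPoints g := by
  obtain ⟨k, hk, -⟩ := existsUnique_add_period_mem_Ico x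
  exact ⟨k, hk, fun w => (hx w).trans_eq (hg x k).symm⟩

lemma eq_of_add_period_eq {x x' : Fin d → ℝ} (hx : ∀ i, x i ∈ Set.Ico 0 (2 * Real.pi))
    (hx' : ∀ i, x' i ∈ Set.Ico 0 (2 * Real.pi)) {k k' : Fin d → ℤ}
    (h : (x + fun i => k i • (2 * Real.pi)) = x' + fun i => k' i • (2 * Real.pi)) : x = x' := by
  have hsub : (x + fun i => (k - k') i • (2 * Real.pi)) = x' := by
    ext i
    have hi := congrFun h i
    simp only [Pi.add_apply, Pi.sub_apply, sub_smul] at hi ⊢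
    linarith
  have hk : k - k' = 0 := (existsUnique_add_period_mem_Ico x).unique
    (by simpa only [hsub] using hx') (by simpa using hx)
  rw [← hsub, hk]
  ext i
  simp

section Continuous

variable {E : Type*} [TopologicalSpace E] {q : E × (Fin d → ℝ) → ℝ} {y₀ : E}

lemma eventually_exists_add_period_mem (hq : Continuous q)
    (hper : TorusPeriodic fun v => q (y₀, v)) {W : Set (Fin d → ℝ)} (hW : IsOpen W)
    (hmax : maxPoints (fun v => q (y₀, v)) ⊆ W) :
    ∀ᶠ y in 𝓝 y₀, ∀ x ∈ maxPoints fun v => q (y, v),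
      ∃ k : Fin d → ℤ, (x + fun i => k i • (2 * Real.pi)) ∈ W := by
  set W' : Set (Fin d → ℝ) := ⋃ k : Fin d → ℤ, (fun x => x + fun i => k i • (2 * Real.pi)) ⁻¹' W
  have hK : IsCompact (torusBox d \ W') := isCompact_Icc.diff <|
    isOpen_iUnion fun k => hW.preimage (continuous_id.add continuous_const)
  obtain ⟨v₀, hv₀⟩ := maxPoints_nonempty (hq.comp (Continuous.prodMk_right y₀)) hper
  have hlt : ∀ x ∈ torusBox d \ W', q (y₀, x) < q (y₀, v₀) := by
    rintro x ⟨-, hx⟩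
    refine lt_of_le_of_ne (hv₀.2 x) fun heq => hx ?_
    obtain ⟨k, hk⟩ := hper.exists_add_period_mem_maxPoints fun w => (hv₀.2 w).trans_eq heq.symm
    exact Set.mem_iUnion.2 ⟨k, hmax hk⟩
  have hevlt : ∀ᶠ y in 𝓝 y₀, ∀ x ∈ torusBox d \ W', q (y, x) < q (y, v₀) :=
    hK.eventually_forall_of_forall_eventually fun x hx =>
      hq.continuousAt.eventually_lt (x₀ := (y₀, x)) (g := fun p => q (p.1, v₀))
        (by fun_prop) (hlt x hx)
  filter_upwards [hevlt] with y hy x hx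
  by_contra hxW
  refine (hy x ⟨⟨fun i => (hx.1 i).1, fun i => (hx.1 i).2.le⟩, fun h => hxW ?_⟩).not_ge (hx.2 v₀)
  simpa [W'] using h

/-- The maximum points for `y` near `y₀` lie, up to periods, on distinct branches, so if there are
at least as many of them as branches then every branch consists of maximum points. -/
lemma eventually_le_apply_branch (hq : Continuous q) (hper : ∀ y, TorusPeriodic fun v => q (y, v))
    (hfin : (maxPoints fun v => q (y₀, v)).Finite)
    (hcard : ∀ᶠ y in 𝓝 y₀,
      (maxPoints fun v => q (y₀, v)).ncard ≤ (maxPoints fun v => q (y, v)).ncard)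
    {w : (Fin d → ℝ) → E → Fin d → ℝ}
    (hw : ∀ v ∈ maxPoints (fun v => q (y₀, v)),
      ∀ᶠ p in 𝓝 (y₀, v), (∀ x, q (p.1, x) ≤ q p) → p.2 = w v p.1) :
    ∀ᶠ y in 𝓝 y₀, ∀ v ∈ maxPoints (fun v => q (y₀, v)), ∀ x, q (y, x) ≤ q (y, w v y) := by
  set m := maxPoints fun v => q (y₀, v)
  have hnhds : ∀ v ∈ m, ∃ N ∈ 𝓝 y₀, ∃ V : Set (Fin d → ℝ), IsOpen V ∧ v ∈ V ∧
      ∀ y ∈ N, ∀ x ∈ V, (∀ z, q (y, z) ≤ q (y, x)) → x = w v y := fun v hv => by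
    obtain ⟨N, V, hN, hyN, hV, hvV, hsub⟩ := mem_nhds_prod_iff'.1 (hw v hv)
    exact ⟨N, hN.mem_nhds hyN, V, hV, hvV, fun y hy x hx => hsub (Set.mk_mem_prod hy hx)⟩
  choose! N hN V hV hvV hbranch using hnhds
  filter_upwards [eventually_exists_add_period_mem hq (hper y₀) (isOpen_biUnion hV)
    fun v hv => Set.mem_biUnion hv (hvV v hv), hfin.eventually_all.2 hN, hcard] with y hW hyN hcard
  have hex : ∀ x ∈ maxPoints (fun v => q (y, v)), ∃ v ∈ m, ∃ k : Fin d → ℤ,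
      (x + fun i => k i • (2 * Real.pi)) = w v y := fun x hx => by
    obtain ⟨k, hk⟩ := hW x hx
    obtain ⟨v, hv, hkv⟩ := Set.mem_iUnion₂.1 hk
    exact ⟨v, hv, k, hbranch v hv y (hyN v hv) _ hkv fun z => (hx.2 z).trans_eq (hper y x k).symm⟩
  choose! f hf k hk using hex
  intro v hv
  obtain ⟨x, hx, rfl⟩ := Set.surj_on_of_inj_on_of_ncard_le (fun x _ => f x) hf
    (fun x x' hx hx' hff => eq_of_add_period_eq hx.1 hx'.1 (by rw [hk x hx, hk x' hx', hff]))
    hcard hfin v hv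
  exact fun z => (hx.2 z).trans_eq (by rw [← hk x hx]; exact (hper y x (k x)).symm)

end Continuous

variable {E : Type*} [NormedAddCommGroup E] [NormedSpace ℝ E] [CompleteSpace E]

theorem contDiffOn_apply_maxPoint {n : WithTop ℕ∞} (hn : n ≠ 0) {q : E × (Fin d → ℝ) → ℝ}
    (hq : ContDiff ℝ (n + 1) q) (hper : ∀ y, TorusPeriodic fun v => q (y, v)) {U : Set E}
    (hU : IsOpen U) {J : ℕ} {v₁ : E → Fin d → ℝ}
    (hmax : ∀ y ∈ U, FiniteNondegMax (fun v => q (y, v)) ∧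
      (maxPoints fun v => q (y, v)).ncard = J ∧ v₁ y ∈ maxPoints fun v => q (y, v)) :
    ContDiffOn ℝ n (fun y => q (y, v₁ y)) U := by
  refine fun y₀ hy₀ => ContDiffAt.contDiffWithinAt ?_
  obtain ⟨⟨hfin, hnondeg⟩, hcard, hv₁⟩ := hmax y₀ hy₀
  have hcrit : ∀ y v, (∀ w, q (y, w) ≤ q (y, v)) → fderiv ℝ (fun v => q (y, v)) v = 0 :=
    fun y v hv => IsLocalMax.fderiv_eq_zero (Eventually.of_forall hv)
  have hbranch := fun v hv => exists_critical_branch hn hq (hcrit y₀ v hv.2)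
    (isInvertible_fderiv_fderiv_of_det_hessian_ne_zero (hnondeg v hv))
  choose! w hw hbranch using hbranch
  have hle := eventually_le_apply_branch hq.continuous hper hfin
    (by filter_upwards [hU.mem_nhds hy₀] with y hy; rw [hcard, (hmax y hy).2.1])
    fun v hv => (hbranch v hv).mono fun p hp hpmax => hp (hcrit p.1 p.2 hpmax)
  have hcongr : (fun y => q (y, v₁ y)) =ᶠ[𝓝 y₀] fun y => q (y, w (v₁ y₀) y) := by
    filter_upwards [hle, hU.mem_nhds hy₀] with y hy hyU
    exact le_antisymm (hy _ hv₁ _) ((hmax y hyU).2.2.2 _)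
  exact ((hq.of_le le_self_add).contDiffAt.comp y₀
    (contDiffAt_id.prodMk (hw _ hv₁))).congr_of_eventuallyEq hcongr

end MaxPoints

/-! ### Functions homogeneous of degree two -/

section Homogeneous

variable {E F : Type*} [NormedAddCommGroup E] [NormedSpace ℝ E] [NormedAddCommGroup F]
  [NormedSpace ℝ F]

lemma exists_norm_le_mul_norm_pow_of_homogeneous [FiniteDimensional ℝ E] {g : E → F} {k : ℕ}
    (hg : ContinuousOn g {0}ᶜ) (hom : ∀ c : ℝ, c ≠ 0 → ∀ y, g (c • y) = c ^ k • g y) :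
    ∃ M, ∀ y ≠ 0, ‖g y‖ ≤ M * ‖y‖ ^ k := by
  obtain ⟨M, hM⟩ := (isCompact_sphere (0 : E) 1).exists_bound_of_continuousOn
    (hg.mono fun y hy => ne_zero_of_mem_unit_sphere ⟨y, hy⟩)
  refine ⟨M, fun y hy => ?_⟩
  have hsphere : ‖y‖⁻¹ • y ∈ Metric.sphere (0 : E) 1 := by simp [norm_smul, hy]
  calc ‖g y‖ = ‖g (‖y‖ • ‖y‖⁻¹ • y)‖ := by rw [smul_inv_smul₀ (norm_ne_zero_iff.2 hy)]
    _ = ‖g (‖y‖⁻¹ • y)‖ * ‖y‖ ^ k := by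
        rw [hom _ (norm_ne_zero_iff.2 hy), norm_smul, norm_pow, norm_norm, mul_comm]
    _ ≤ M * ‖y‖ ^ k := by
        gcongr
        exact hM _ hsphere

lemma fderiv_smul_of_homogeneous {L : E → F}
    (hom : ∀ c : ℝ, c ≠ 0 → ∀ y, L (c • y) = c ^ 2 • L y) {c : ℝ} (hc : c ≠ 0) (y : E) :
    fderiv ℝ L (c • y) = c • fderiv ℝ L y := by
  have h := fderiv_comp_smul (f := L) (x := y) c
  rw [show (L <| c • ·) = c ^ 2 • L from funext (hom c hc), fderiv_const_smul_field, sq,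
    mul_smul] at h
  exact (smul_right_injective _ hc h).symm

theorem contDiff_one_of_homogeneous [FiniteDimensional ℝ E] {L : E → F}
    (hL : ContDiffOn ℝ 1 L {0}ᶜ) (hom : ∀ (c : ℝ) y, L (c • y) = c ^ 2 • L y) :
    ContDiff ℝ 1 L := by
  have hopen : IsOpen ({0}ᶜ : Set E) := isOpen_compl_singleton
  have hderiv : ContinuousOn (fderiv ℝ L) {0}ᶜ := hL.continuousOn_fderiv_of_isOpen hopen le_rfl
  obtain ⟨M, hM⟩ := exists_norm_le_mul_norm_pow_of_homogeneous hL.continuousOn fun c _ => hom c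
  obtain ⟨M', hM'⟩ := exists_norm_le_mul_norm_pow_of_homogeneous (k := 1) hderiv
    fun c hc y => by rw [pow_one, fderiv_smul_of_homogeneous (fun c _ => hom c) hc]
  have hL0 : L 0 = 0 := by simpa using hom 0 0
  have hzero : HasFDerivAt L (0 : E →L[ℝ] F) 0 := by
    have hO : L =O[𝓝 0] fun y => ‖y‖ ^ 2 := .of_bound M <| Eventually.of_forall fun y => by
      rcases eq_or_ne y 0 with rfl | hy
      · simp [hL0]
      · simpa using hM y hy
    refine .of_isLittleO ?_
    simpa [hL0] using hO.trans_isLittleO (Asymptotics.isLittleO_norm_pow_id one_lt_two)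
  rw [contDiff_one_iff_fderiv]
  refine ⟨fun y => ?_, continuous_iff_continuousAt.2 fun y => ?_⟩
  · rcases eq_or_ne y 0 with rfl | hy
    · exact hzero.differentiableAt
    · exact (hL.contDiffAt (hopen.mem_nhds hy)).differentiableAt one_ne_zero
  · rcases eq_or_ne y 0 with rfl | hy
    · have hlim : Tendsto (fun y : E => M' * ‖y‖ ^ 1) (𝓝 0) (𝓝 0) :=
        Continuous.tendsto' (by fun_prop) _ _ (by simp)
      rw [← continuousWithinAt_compl_self, ContinuousWithinAt, hzero.fderiv]
      exact squeeze_zero_norm' (eventually_mem_nhdsWithin.mono hM')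
        (hlim.mono_left nhdsWithin_le_nhds)
    · exact hderiv.continuousAt (hopen.mem_nhds hy)

end Homogeneous

/-! ### Convexity and regularity of the limit -/

lemma convexOn_log_sum_exp {ι E : Type*} [AddCommGroup E] [Module ℝ E] {s : Finset ι}
    {S : Set E} (hS : Convex ℝ S) {w : ι → ℝ} (hw : ∀ i ∈ s, 0 ≤ w i) {f : ι → E → ℝ}
    (hf : ∀ i ∈ s, ConvexOn ℝ S (f i)) :
    ConvexOn ℝ S fun x => Real.log (∑ i ∈ s, w i * Real.exp (f i x)) := by
  set Z : E → ℝ := fun x => ∑ i ∈ s, w i * Real.exp (f i x)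
  change ConvexOn ℝ S fun x => Real.log (Z x)
  by_cases hzero : ∀ i ∈ s, w i = 0
  · have hZ : Z = 0 := funext fun x => Finset.sum_eq_zero fun i hi => by rw [hzero i hi, zero_mul]
    simpa [hZ] using convexOn_const (0 : ℝ) hS
  push Not at hzero
  have hZ : ∀ x, 0 < Z x := fun x => by
    obtain ⟨i, hi, hwi⟩ := hzero
    exact Finset.sum_pos' (fun j hj => mul_nonneg (hw j hj) (Real.exp_pos _).le)
      ⟨i, hi, mul_pos ((hw i hi).lt_of_ne' hwi) (Real.exp_pos _)⟩
  refine ⟨hS, fun x hx y hy a b ha hb hab => ?_⟩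
  rw [Real.log_le_iff_le_exp (hZ _)]
  set m := a * Real.log (Z x) + b * Real.log (Z y)
  have hterm : ∀ i ∈ s, Real.exp (f i (a • x + b • y)) ≤
      Real.exp m * (a * (Real.exp (f i x) / Z x) + b * (Real.exp (f i y) / Z y)) := fun i hi => by
    calc Real.exp (f i (a • x + b • y))
        ≤ Real.exp (m + (a * (f i x - Real.log (Z x)) + b * (f i y - Real.log (Z y)))) := by
          gcongr
          have hfi := (hf i hi).2 hx hy ha hb hab
          simp only [smul_eq_mul] at hfi
          simp only [m]
          linarith
      _ ≤ Real.exp m * (a * Real.exp (f i x - Real.log (Z x)) +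
            b * Real.exp (f i y - Real.log (Z y))) := by
          rw [Real.exp_add]
          gcongr
          exact convexOn_exp.2 trivial trivial ha hb hab
      _ = _ := by simp only [Real.exp_sub, Real.exp_log (hZ _)]
  calc Z (a • x + b • y) ≤ ∑ i ∈ s, w i *
        (Real.exp m * (a * (Real.exp (f i x) / Z x) + b * (Real.exp (f i y) / Z y))) :=
        Finset.sum_le_sum fun i hi => mul_le_mul_of_nonneg_left (hterm i hi) (hw i hi)
    _ = Real.exp m * (a * (Z x / Z x) + b * (Z y / Z y)) := by
        simp only [Z, Finset.sum_div, Finset.mul_sum, ← Finset.sum_add_distrib]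
        exact Finset.sum_congr rfl fun i _ => by ring
    _ = Real.exp m := by simp [(hZ _).ne', hab]

section MaxQuad

variable {d : ℕ} {Ω : Type*} [MeasurableSpace Ω] {μ : Measure Ω} {C : Ω → Coin d}
  {r : CoinIdx d → Fin d → ℤ} {v₁ : (Fin d → ℝ) → Fin d → ℝ}

lemma convexOn_logGen [IsProbabilityMeasure μ] {φ₀ : CoinIdx d → ℂ} {a : ℕ → ℝ} (n : ℕ) :
    ConvexOn ℝ Set.univ (logGen μ C r φ₀ a n) := by
  have hsum : logGen μ C r φ₀ a n = fun y => Real.log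
      (∑ k ∈ reach r n, avgProb μ C r φ₀ n k * Real.exp (y ⬝ᵥ rescaledPos r a n k)) := by
    ext y
    rw [logGen, tsum_eq_sum fun k hk => by rw [avgProb_eq_zero_of_notMem_reach hk, zero_mul]]
  rw [hsum]
  refine convexOn_log_sum_exp convex_univ
    (fun k _ => integral_nonneg fun ω => Finset.sum_nonneg fun τ _ => sq_nonneg _) fun k _ => ?_
  exact LinearMap.convexOn ((dotProductBilin ℝ ℝ).flip (rescaledPos r a n k)) convex_univ

theorem convexOn_max_quad [IsProbabilityMeasure μ] (hC : MeasurableCoin C)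
    (hS : SimpleEigenvalueOne μ C r) {φ₀ : CoinIdx d → ℂ} (hφ₀ : ∑ τ, ‖φ₀ τ‖ ^ 2 = 1) {a : ℕ → ℝ}
    (ha_top : Tendsto a atTop atTop) (ha_zero : Tendsto (fun n : ℕ => a n / n) atTop (𝓝 0))
    (hmax : ∀ y, y ≠ 0 → v₁ y ∈ maxPoints (quad μ C r y)) :
    ConvexOn ℝ Set.univ fun y => 1 / 2 * quad μ C r y (v₁ y) := by
  have hlim : ∀ y, Tendsto (fun n : ℕ => 1 / a n * logGen μ C r φ₀ a n (a n • y)) atTop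
      (𝓝 (1 / 2 * quad μ C r y (v₁ y))) := fun y => by
    rcases eq_or_ne y 0 with rfl | hy
    · have hquad : ∀ v, quad μ C r 0 v = 0 := fun v => by simp [quad]
      obtain ⟨v, hv⟩ := maxPoints_nonempty (continuous_quad hC hS 0) (torusPeriodic_quad 0)
      simpa only [hquad] using tendsto_logGen hC hS hφ₀ ha_top ha_zero hv
    · exact tendsto_logGen hC hS hφ₀ ha_top ha_zero (hmax y hy)
  refine isClosed_setOfPred_convexOn.mem_of_tendsto (tendsto_pi_nhds.2 hlim) ?_
  filter_upwards [ha_top.eventually_ge_atTop 0] with n hn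
  exact ((convexOn_logGen n).comp_linearMap (LinearMap.lsmul ℝ _ (a n))).smul (by positivity)

lemma max_quad_smul (hmax : ∀ y, y ≠ 0 → v₁ y ∈ maxPoints (quad μ C r y)) (c : ℝ)
    (y : Fin d → ℝ) :
    quad μ C r (c • y) (v₁ (c • y)) = c ^ 2 * quad μ C r y (v₁ y) := by
  have hle : ∀ y v, quad μ C r y v ≤ quad μ C r y (v₁ y) := fun y v => by
    rcases eq_or_ne y 0 with rfl | hy
    · simp [quad]
    · exact (hmax y hy).2 v
  refine le_antisymm ?_ ?_
  · rw [quad_smul]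
    gcongr
    exact hle _ _
  · rw [← quad_smul]
    exact hle _ _

lemma contDiff_max_quad_of_dim_one {C : Ω → Coin 1} {r : CoinIdx 1 → Fin 1 → ℤ}
    {v₁ : (Fin 1 → ℝ) → Fin 1 → ℝ} (hmax : ∀ y, y ≠ 0 → v₁ y ∈ maxPoints (quad μ C r y))
    {n : WithTop ℕ∞} : ContDiff ℝ n fun y => quad μ C r y (v₁ y) := by
  have hquad : ∀ y, quad μ C r y (v₁ y) = y 0 ^ 2 * quad μ C r 1 (v₁ 1) := fun y => by
    have hy : y 0 • (1 : Fin 1 → ℝ) = y := by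
      ext i
      simp [Subsingleton.elim i 0]
    rw [← max_quad_smul hmax, hy]
  rw [funext hquad]
  fun_prop

lemma contDiff_quad_of_diffusion_const (hconst : ∀ v w, diffusion μ C r v = diffusion μ C r w)
    {n : WithTop ℕ∞} : ContDiff ℝ n fun y => quad μ C r y (v₁ y) := by
  have hquad : ∀ y, quad μ C r y (v₁ y) = y ⬝ᵥ (diffusion μ C r 0 *ᵥ y) := fun y => by
    rw [quad, hconst (v₁ y) 0]
  simp only [hquad, dotProduct, mulVec]
  fun_prop

variable [IsProbabilityMeasure μ]

theorem contDiffOn_max_quad (hC : MeasurableCoin C) (hS : SimpleEigenvalueOne μ C r)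
    {U : Set (Fin d → ℝ)} (hU : IsOpen U) {J : ℕ}
    (hmax : ∀ y ∈ U, FiniteNondegMax (quad μ C r y) ∧ (maxPoints (quad μ C r y)).ncard = J ∧
      v₁ y ∈ maxPoints (quad μ C r y)) {n : ℕ∞} :
    ContDiffOn ℝ n (fun y => quad μ C r y (v₁ y)) U :=
  (contDiffOn_apply_maxPoint (n := (⊤ : ℕ∞)) (by simp) (contDiff_quad hC hS) torusPeriodic_quad hU
    hmax).of_le (by exact_mod_cast le_top)

theorem contDiff_one_max_quad (hC : MeasurableCoin C) (hS : SimpleEigenvalueOne μ C r) {J : ℕ}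
    (hmax : ∀ y, y ≠ 0 → FiniteNondegMax (quad μ C r y) ∧ (maxPoints (quad μ C r y)).ncard = J ∧
      v₁ y ∈ maxPoints (quad μ C r y)) :
    ContDiff ℝ 1 fun y => quad μ C r y (v₁ y) :=
  contDiff_one_of_homogeneous (contDiffOn_max_quad hC hS isOpen_compl_singleton hmax)
    (max_quad_smul fun y hy => (hmax y hy).2.2)

end MaxQuad

end

end RandomQW

open RandomQW in
theorem mainTheorem4_general {d : ℕ} {Ω : Type*} [MeasurableSpace Ω] (μ : Measure Ω)
    [IsProbabilityMeasure μ] (C : Ω → Coin d) (hC : MeasurableCoin C)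
    (r : CoinIdx d → Fin d → ℤ) (hS : SimpleEigenvalueOne μ C r)
    (φ₀ : CoinIdx d → ℂ) (hφ₀ : ∑ τ, ‖φ₀ τ‖ ^ 2 = 1)
    (a : ℕ → ℝ) (ha_top : Tendsto a atTop atTop)
    (ha_zero : Tendsto (fun n : ℕ => a n / n) atTop (𝓝 0)) :
    (∀ y, (maxPoints (quad μ C r y)).Nonempty) ∧
    (∀ y, ∀ v₁ ∈ maxPoints (quad μ C r y),
      Tendsto (fun n : ℕ => 1 / a n * logGen μ C r φ₀ a n (a n • y)) atTop
        (𝓝 (1 / 2 * quad μ C r y v₁))) ∧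
    ∀ v₁ : (Fin d → ℝ) → Fin d → ℝ,
      ((∀ y, y ≠ 0 → v₁ y ∈ maxPoints (quad μ C r y)) →
        ConvexOn ℝ Set.univ fun y => 1 / 2 * quad μ C r y (v₁ y)) ∧
      (∀ (U : Set (Fin d → ℝ)) (J : ℕ), IsOpen U →
        (∀ y ∈ U, FiniteNondegMax (quad μ C r y) ∧ (maxPoints (quad μ C r y)).ncard = J ∧
          v₁ y ∈ maxPoints (quad μ C r y)) →
        ContDiffOn ℝ ((⊤ : ℕ∞) : WithTop ℕ∞) (fun y => 1 / 2 * quad μ C r y (v₁ y)) U) ∧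
      (∀ J : ℕ, (∀ y, y ≠ 0 → FiniteNondegMax (quad μ C r y) ∧
          (maxPoints (quad μ C r y)).ncard = J ∧ v₁ y ∈ maxPoints (quad μ C r y)) →
        ContDiff ℝ 1 fun y => 1 / 2 * quad μ C r y (v₁ y)) ∧
      ((∀ y, y ≠ 0 → v₁ y ∈ maxPoints (quad μ C r y)) →
        (d = 1 ∨ ∀ v w, diffusion μ C r v = diffusion μ C r w) →
        ContDiff ℝ ((⊤ : ℕ∞) : WithTop ℕ∞) fun y => 1 / 2 * quad μ C r y (v₁ y)) := by
  refine ⟨fun y => maxPoints_nonempty (continuous_quad hC hS y) (torusPeriodic_quad y),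
    fun y v₁ hv₁ => tendsto_logGen hC hS hφ₀ ha_top ha_zero hv₁, fun v₁ => ⟨fun hmax =>
      convexOn_max_quad hC hS hφ₀ ha_top ha_zero hmax, fun U J hU hmax => ?_, fun J hmax => ?_,
      fun hmax hcase => ?_⟩⟩
  · exact contDiffOn_const.mul (contDiffOn_max_quad hC hS hU hmax)
  · exact contDiff_const.mul (contDiff_one_max_quad hC hS hmax)
  · rcases hcase with rfl | hconst
    · exact contDiff_const.mul (contDiff_max_quad_of_dim_one hmax)
    · exact contDiff_const.mul (contDiff_quad_of_diffusion_const hconst)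

theorem mainTheorem4 {d : ℕ} {Ω : Type*} [MeasurableSpace Ω] (μ : Measure Ω)
    [IsProbabilityMeasure μ] (C : Ω → RandomQW.Coin d)
    (hC : ∀ τ σ, Measurable fun ω => (C ω : Matrix (RandomQW.CoinIdx d) (RandomQW.CoinIdx d) ℂ) τ σ)
    (r : RandomQW.CoinIdx d → Fin d → ℤ)
    (φ₀ : RandomQW.CoinIdx d → ℂ) (hφ₀ : ∑ τ, ‖φ₀ τ‖ ^ 2 = 1)
    (hS : RandomQW.AssumptionS μ C r)
    (hD : ∀ v, (RandomQW.diffusion μ C r v).PosDef)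
    (a : ℕ → ℝ) (ha : ∀ n, 0 < a n) (ha_top : Tendsto a atTop atTop)
    (ha_zero : Tendsto (fun n : ℕ => a n / n) atTop (𝓝 0)) :
    -- maximum points exist
    (∀ y : Fin d → ℝ, (RandomQW.maxPoints (RandomQW.quad μ C r y)).Nonempty) ∧
    -- the limit, for each `y` separately
    (∀ y : Fin d → ℝ, RandomQW.ConstOrNondegMax (RandomQW.quad μ C r y) →
      ∀ v₁ ∈ RandomQW.maxPoints (RandomQW.quad μ C r y),
        Tendsto (fun n : ℕ => 1 / a n * RandomQW.logGen μ C r φ₀ a n (a n • y)) atTop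
          (𝓝 (1 / 2 * RandomQW.quad μ C r y v₁))) ∧
    -- properties of the limit as a function of `y`
    (∀ v₁ : (Fin d → ℝ) → Fin d → ℝ,
      -- convexity
      ((∀ y, y ≠ 0 → RandomQW.ConstOrNondegMax (RandomQW.quad μ C r y) ∧
          v₁ y ∈ RandomQW.maxPoints (RandomQW.quad μ C r y)) →
        ConvexOn ℝ Set.univ fun y => 1 / 2 * RandomQW.quad μ C r y (v₁ y)) ∧
      -- smoothness where the number of maximum points is constant
      (∀ (U : Set (Fin d → ℝ)) (J : ℕ), IsOpen U →
        (∀ y ∈ U, RandomQW.FiniteNondegMax (RandomQW.quad μ C r y) ∧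
          (RandomQW.maxPoints (RandomQW.quad μ C r y)).ncard = J ∧
          v₁ y ∈ RandomQW.maxPoints (RandomQW.quad μ C r y)) →
        ContDiffOn ℝ ((⊤ : ℕ∞) : WithTop ℕ∞) (fun y => 1 / 2 * RandomQW.quad μ C r y (v₁ y)) U) ∧
      -- regularity at the origin
      (∀ J : ℕ, (∀ y, y ≠ 0 → RandomQW.FiniteNondegMax (RandomQW.quad μ C r y) ∧
          (RandomQW.maxPoints (RandomQW.quad μ C r y)).ncard = J ∧
          v₁ y ∈ RandomQW.maxPoints (RandomQW.quad μ C r y)) →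
        ContDiff ℝ 1 fun y => 1 / 2 * RandomQW.quad μ C r y (v₁ y)) ∧
      -- smoothness on the whole space
      ((∀ y, y ≠ 0 → v₁ y ∈ RandomQW.maxPoints (RandomQW.quad μ C r y)) →
        (d = 1 ∨ ∀ v w, RandomQW.diffusion μ C r v = RandomQW.diffusion μ C r w) →
        ContDiff ℝ ((⊤ : ℕ∞) : WithTop ℕ∞) fun y => 1 / 2 * RandomQW.quad μ C r y (v₁ y))) := by
  obtain ⟨hne, hlim, hL⟩ :=
    mainTheorem4_general μ C hC r (fun v => (hS v).2) φ₀ hφ₀ a ha_top ha_zero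
  exact ⟨hne, fun y _ => hlim y, fun v₁ => ⟨fun h => (hL v₁).1 fun y hy => (h y hy).2, (hL v₁).2⟩⟩
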